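/- Let $\mathbb{F}=\mathbb{R}$ or $\mathbb{F}=\mathbb{C}$, and let $(X,d)$ be a proper metric space (closed bounded subsets are compact). A representation of $\mathrm{C}_0(X)=\mathrm{C}_0(X,\mathbb{F})$ on a separable Hilbert space $\mathcal{H}$ over $\mathbb{F}$ is a $*$-homomorphism $\varrho\colon \mathrm{C}_0(X)\to\mathbb{B}(\mathcal{H})$ that is nondegenerate, that is, the vectors $\varrho(f)\xi$ span a dense subspace of $\mathcal{H}$. It is *ample* if $\varrho(f)$ is compact only for $f=0$. An operator $T\in\mathbb{B}(\mathcal{H})$ is *locally compact* if $\varrho(f)T$ and $T\varrho(f)$ are compact for all $f\in\mathrm{C}_0(X)$. Its *support* is the set of those $(x,y)\in X\times X$ for which there are no open neighbourhoods $U\ni x$, $V\ni y$ with $\varrho(f)T\varrho(g)=0$ for all $f,g\in \mathrm{C}_0(X)$ such that $f$ vanishes outside $U$ and $g$ vanishes outside $V$. And $T$ is *controlled* if there is $R>0$ with $d(x,y)\le R$ for all $(x,y)$ in the support of $T$. The *Roe $\mathrm{C}^*$-algebra* $\mathrm{C}^*_{\mathrm{Roe}}(X,\varrho)$ is the norm closure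 in $\mathbb{B}(\mathcal{H})$ of the $*$-algebra of locally compact, controlled operators. A closed subset $Y\subseteq X$, with the restricted metric, is *coarsely dense* if there is $R>0$ such that for every $x\in X$ there is $y\in Y$ with $d(x,y)\le R$. **Theorem.** Let $Y\subseteq X$ be closed and coarsely dense. Let $\varrho_Y\colon \mathrm{C}_0(Y)\to\mathbb{B}(\mathcal{H}_Y)$ and $\varrho_X\colon \mathrm{C}_0(X)\to\mathbb{B}(\mathcal{H}_X)$ be any ample representations on separable Hilbert spaces over the same field $\mathbb{F}\in\{\mathbb{R},\mathbb{C}\}$. Then there is a unitary operator $U\colon\mathcal{H}_Y\to\mathcal{H}_X$ such that $T\mapsto UTU^*$ is a $*$-isomorphism from $\mathrm{C}^*_{\mathrm{Roe}}(Y,\varrho_Y)$ onto $\mathrm{C}^*_{\mathrm{Roe}}(X,\varrho_X)$. In particular, let $d\in\mathbb{N}$ and consider the following subsets of $\mathbb{R}^d$ with the Euclidean metric: $\mathbb{R}^d$ itself, $\mathbb{Z}^d$, and all Delone sets. The Roe $\mathrm{C}^*$-algebra of $\mathbb{Z}^d$ or of any Delone set is isomorphic to that of $\mathbb{R}^d$,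 and the Roe $\mathrm{C}^*$-algebras of any two such subsets are isomorphic, for any ample representations over $\mathbb{F}$; all these isomorphisms are implemented by unitaries between the underlying Hilbert spaces. -/

import Mathlib

open scoped ZeroAtInfty

namespace RoeAlg

/-! ### Roe C*-algebras

`𝕜` is `ℝ` or `ℂ`; `C₀(X, 𝕜)` acts on a real or complex Hilbert space `H` through a
`*`-homomorphism `ρ : C₀(X, 𝕜) →⋆ₙₐ[𝕜] (H →L[𝕜] H)`. -/

/-- `ρ` is nondegenerate: the vectors `ρ f v` span a dense subspace of `H`. -/
def Nondegenerate {𝕜 X H : Type*} [RCLike 𝕜] [TopologicalSpace X]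
    [NormedAddCommGroup H] [InnerProductSpace 𝕜 H] [CompleteSpace H]
    (ρ : C₀(X, 𝕜) →⋆ₙₐ[𝕜] (H →L[𝕜] H)) : Prop :=
  Dense (Submodule.span 𝕜 {w : H | ∃ (f : C₀(X, 𝕜)) (v : H), ρ f v = w} : Set H)

/-- `ρ` is ample: `ρ f` is a compact operator only for `f = 0`. -/
def Ample {𝕜 X H : Type*} [RCLike 𝕜] [TopologicalSpace X]
    [NormedAddCommGroup H] [InnerProductSpace 𝕜 H] [CompleteSpace H]
    (ρ : C₀(X, 𝕜) →⋆ₙₐ[𝕜] (H →L[𝕜] H)) : Prop :=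
  ∀ f : C₀(X, 𝕜), IsCompactOperator (ρ f) → f = 0

/-- `T` is locally compact: `ρ f ∘ T` and `T ∘ ρ f` are compact for all `f ∈ C₀(X)`. -/
def LocallyCompactOp {𝕜 X H : Type*} [RCLike 𝕜] [TopologicalSpace X]
    [NormedAddCommGroup H] [InnerProductSpace 𝕜 H] [CompleteSpace H]
    (ρ : C₀(X, 𝕜) →⋆ₙₐ[𝕜] (H →L[𝕜] H)) (T : H →L[𝕜] H) : Prop :=
  ∀ f : C₀(X, 𝕜), IsCompactOperator (ρ f * T) ∧ IsCompactOperator (T * ρ f)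

/-- The support of `T`, a subset of `X × X`. A pair `(x, y)` is outside of it iff there are open
neighbourhoods `U` of `x` and `V` of `y` with `ρ f ∘ T ∘ ρ g = 0` for all `f ∈ C₀(U)`,
`g ∈ C₀(V)`; here `C₀(U)` consists of the `f ∈ C₀(X)` that vanish outside `U`. -/
def opSupport {𝕜 X H : Type*} [RCLike 𝕜] [TopologicalSpace X]
    [NormedAddCommGroup H] [InnerProductSpace 𝕜 H] [CompleteSpace H]
    (ρ : C₀(X, 𝕜) →⋆ₙₐ[𝕜] (H →L[𝕜] H)) (T : H →L[𝕜] H) : Set (X × X) :=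
  {p | ∃ U V : Set X, IsOpen U ∧ p.1 ∈ U ∧ IsOpen V ∧ p.2 ∈ V ∧
    ∀ f g : C₀(X, 𝕜), (∀ x ∉ U, f x = 0) → (∀ x ∉ V, g x = 0) → ρ f * T * ρ g = 0}ᶜ

/-- `T` is controlled (has finite propagation). -/
def Controlled {𝕜 X H : Type*} [RCLike 𝕜] [MetricSpace X]
    [NormedAddCommGroup H] [InnerProductSpace 𝕜 H] [CompleteSpace H]
    (ρ : C₀(X, 𝕜) →⋆ₙₐ[𝕜] (H →L[𝕜] H)) (T : H →L[𝕜] H) : Prop :=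
  ∃ R : ℝ, 0 < R ∧ ∀ p ∈ opSupport ρ T, dist p.1 p.2 ≤ R

/-- The set of locally compact, controlled operators on `H`. -/
def locallyCompactControlled {𝕜 X H : Type*} [RCLike 𝕜] [MetricSpace X]
    [NormedAddCommGroup H] [InnerProductSpace 𝕜 H] [CompleteSpace H]
    (ρ : C₀(X, 𝕜) →⋆ₙₐ[𝕜] (H →L[𝕜] H)) : Set (H →L[𝕜] H) :=
  {T | LocallyCompactOp ρ T ∧ Controlled ρ T}

/-- The Roe C*-algebra of `ρ`: the norm closure of the `*`-algebra of locally compact, controlled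
operators. If `X` is proper and `ρ` is nondegenerate, then `locallyCompactControlled ρ` is
already a `*`-algebra, so that `NonUnitalStarAlgebra.adjoin` adds nothing and the Roe algebra is
the closure of this set: see `coe_adjoin_locallyCompactControlled` and `coe_roeAlgebra` below. -/
noncomputable def roeAlgebra {𝕜 X H : Type*} [RCLike 𝕜] [MetricSpace X]
    [NormedAddCommGroup H] [InnerProductSpace 𝕜 H] [CompleteSpace H]
    (ρ : C₀(X, 𝕜) →⋆ₙₐ[𝕜] (H →L[𝕜] H)) : NonUnitalStarSubalgebra 𝕜 (H →L[𝕜] H) :=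
  (NonUnitalStarAlgebra.adjoin 𝕜 (locallyCompactControlled ρ)).topologicalClosure

/-- `A` and `B` are isomorphic as C*-algebras through a unitary `U` between the underlying
Hilbert spaces: `T ↦ U T U*` restricts to a `*`-isomorphism from `A` onto `B`. -/
def UnitarilyIsomorphic {𝕜 H K : Type*} [RCLike 𝕜]
    [NormedAddCommGroup H] [InnerProductSpace 𝕜 H] [CompleteSpace H]
    [NormedAddCommGroup K] [InnerProductSpace 𝕜 K] [CompleteSpace K]
    (A : NonUnitalStarSubalgebra 𝕜 (H →L[𝕜] H)) (B : NonUnitalStarSubalgebra 𝕜 (K →L[𝕜] K)) :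
    Prop :=
  ∃ (U : H ≃ₗᵢ[𝕜] K) (φ : A ≃⋆ₐ[𝕜] B), ∀ (T : A) (v : K),
    (φ T : K →L[𝕜] K) v = U ((T : H →L[𝕜] H) (U.symm v))

/-- `Y` is coarsely dense in `X`: some `R > 0` is such that every point of `X` has distance at
most `R` to a point of `Y`. -/
def CoarselyDense {X : Type*} [MetricSpace X] (Y : Set X) : Prop :=
  ∃ R : ℝ, 0 < R ∧ ∀ x : X, ∃ y ∈ Y, dist x y ≤ R

/-- The integer lattice `ℤᵈ` in `ℝᵈ`. -/
def integerLattice (d : ℕ) : Set (EuclideanSpace ℝ (Fin d)) :=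
  {x | ∀ i, ∃ n : ℤ, x i = n}

/-! ### The locally compact, controlled operators form a `*`-algebra -/

section StarAlgebra

variable {𝕜 X H : Type*} [RCLike 𝕜] [MetricSpace X]
    [NormedAddCommGroup H] [InnerProductSpace 𝕜 H] [CompleteSpace H]
    {ρ : C₀(X, 𝕜) →⋆ₙₐ[𝕜] (H →L[𝕜] H)}

theorem isCompactOperator_adjoint {A : H →L[𝕜] H} (hA : IsCompactOperator A) :
    IsCompactOperator (star A : H →L[𝕜] H) := by
  have hB : IsCompactOperator (A * star A) := hA.comp_clm (star A)
  have h1 := hB.isCompact_closure_image_closedBall (𝕜₁ := 𝕜)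
    (f := ((A * star A : H →L[𝕜] H) : H →ₗ[𝕜] H)) 1
  refine (isCompactOperator_iff_isCompact_closure_image_closedBall (𝕜₁ := 𝕜)
    ((star A : H →L[𝕜] H) : H →ₗ[𝕜] H) (r := 1) one_pos).2 ?_
  refine TotallyBounded.isCompact_of_isClosed (TotallyBounded.closure ?_) isClosed_closure
  have h2 := h1.totallyBounded.subset subset_closure
  rw [Metric.totallyBounded_iff]
  intro ε hε
  obtain ⟨t, ht, htf, hcov⟩ := totallyBounded_iff_subset.1 h2 _
    (Metric.dist_mem_uniformity (show 0 < ε ^ 2 / 4 by positivity))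
  have ht' : ∀ z ∈ t, ∃ y : H, y ∈ Metric.closedBall (0 : H) 1 ∧ A (star A y) = z :=
    fun z hz => ht hz
  choose! p hp hpt using ht'
  refine ⟨(fun z => star A (p z)) '' t, htf.image _, ?_⟩
  rintro _ ⟨x, hx, rfl⟩
  obtain ⟨z, hz, hxz⟩ := Set.mem_iUnion₂.1 (hcov ⟨x, hx, rfl⟩)
  refine Set.mem_iUnion₂.2 ⟨_, ⟨z, hz, rfl⟩, ?_⟩
  have hz1 := hp z hz
  have hz2 := hpt z hz
  simp only [Metric.mem_closedBall, dist_zero_right] at hx hz1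
  have hd : ‖A (star A (x - p z))‖ < ε ^ 2 / 4 := by
    have : dist (A (star A x)) z < ε ^ 2 / 4 := hxz
    rw [← hz2] at this
    simpa [dist_eq_norm] using this
  have hn : ‖x - p z‖ ≤ 2 := by
    calc ‖x - p z‖ ≤ ‖x‖ + ‖p z‖ := norm_sub_le _ _
      _ ≤ 2 := by linarith
  have hsq : ‖star A (x - p z)‖ ^ 2 ≤ ‖A (star A (x - p z))‖ * ‖x - p z‖ := by
    rw [← @inner_self_eq_norm_sq 𝕜]
    have : inner 𝕜 (star A (x - p z)) (star A (x - p z))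
        = inner 𝕜 (A (star A (x - p z))) (x - p z) := by
      rw [ContinuousLinearMap.star_eq_adjoint, ContinuousLinearMap.adjoint_inner_right]
    rw [this]
    exact (RCLike.re_le_norm _).trans (norm_inner_le_norm _ _)
  have h3 : ‖star A (x - p z)‖ ^ 2 < ε ^ 2 := by
    nlinarith [norm_nonneg (A (star A (x - p z))), norm_nonneg (x - p z), sq_nonneg ε]
  have h4 : ‖star A (x - p z)‖ < ε := lt_of_pow_lt_pow_left₀ 2 hε.le h3
  simpa [dist_eq_norm] using h4

theorem norm_rep_apply_le (f : C₀(X, 𝕜)) (v : H) : ‖ρ f v‖ ≤ ‖f‖ * ‖v‖ := by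
  set c : ℝ := ‖f‖ with hc
  have hfx : ∀ x, ‖f x‖ ≤ c := fun x => by
    rw [hc, ← ZeroAtInftyContinuousMap.norm_toBCF_eq_norm]
    exact f.toBCF.norm_coe_le_norm x
  have hc0 : 0 ≤ c := norm_nonneg f
  let q : 𝕜 → 𝕜 := fun z => ((c - √(c ^ 2 - ‖z‖ ^ 2) : ℝ) : 𝕜)
  have hq : Continuous q := by fun_prop
  have hq0 : q 0 = 0 := by simp [q, Real.sqrt_sq hc0]
  let s : C₀(X, 𝕜) :=
    { toFun := fun x => q (f x)
      continuous_toFun := hq.comp (map_continuous f)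
      zero_at_infty' := by
        have := (hq.tendsto 0).comp (zero_at_infty f)
        rwa [hq0] at this }
  have hsx : ∀ x, s x = ((c - √(c ^ 2 - ‖f x‖ ^ 2) : ℝ) : 𝕜) := fun x => rfl
  have hs_star : star s = s := by
    ext x
    rw [ZeroAtInftyContinuousMap.star_apply, hsx]
    simp
  have hff : star f * f = (2 * (c : 𝕜)) • s - star s * s := by
    rw [hs_star]
    ext x
    simp only [ZeroAtInftyContinuousMap.mul_apply, ZeroAtInftyContinuousMap.star_apply,
      ZeroAtInftyContinuousMap.sub_apply, ZeroAtInftyContinuousMap.smul_apply, hsx, smul_eq_mul]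
    have h1 : star (f x) * f x = ((‖f x‖ ^ 2 : ℝ) : 𝕜) := by
      simpa using RCLike.conj_mul (f x)
    rw [h1]
    norm_cast
    have h2 : √(c ^ 2 - ‖f x‖ ^ 2) ^ 2 = c ^ 2 - ‖f x‖ ^ 2 :=
      Real.sq_sqrt (by nlinarith [hfx x, norm_nonneg (f x)])
    nlinarith
  have hnorm : ∀ g : C₀(X, 𝕜), ‖ρ g v‖ ^ 2 = RCLike.re (inner 𝕜 v (ρ (star g * g) v)) := by
    intro g
    rw [← @inner_self_eq_norm_sq 𝕜, map_mul, map_star, ContinuousLinearMap.star_eq_adjoint,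
      mul_apply_eq_comp, ContinuousLinearMap.adjoint_inner_right]
  have h3 := hnorm f
  rw [hff, map_sub, map_smul, sub_apply, inner_sub_right, map_sub,
    ← hnorm s, smul_apply, inner_smul_right] at h3
  have h4 : RCLike.re (2 * (c : 𝕜) * inner 𝕜 v (ρ s v)) = 2 * c * RCLike.re (inner 𝕜 v (ρ s v)) := by
    rw [show (2 * (c : 𝕜)) = ((2 * c : ℝ) : 𝕜) by push_cast; rfl, RCLike.re_ofReal_mul]
  rw [h4] at h3
  have h5 : ‖(c : 𝕜) • v - ρ s v‖ ^ 2
      = c ^ 2 * ‖v‖ ^ 2 - 2 * (c * RCLike.re (inner 𝕜 v (ρ s v))) + ‖ρ s v‖ ^ 2 := by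
    rw [@norm_sub_sq 𝕜, norm_smul, inner_smul_left, RCLike.conj_ofReal, RCLike.re_ofReal_mul,
      RCLike.norm_ofReal, abs_of_nonneg hc0]
    ring
  have h6 : ‖ρ f v‖ ^ 2 ≤ (c * ‖v‖) ^ 2 := by nlinarith [sq_nonneg ‖(c : 𝕜) • v - ρ s v‖]
  exact (sq_le_sq₀ (norm_nonneg _) (by positivity)).1 h6

/-- A compactly supported continuous real function as an element of `C₀(X, 𝕜)`. -/
def ofCompactSupport (𝕜 : Type*) [RCLike 𝕜] {X : Type*} [MetricSpace X] (φ : C(X, ℝ))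
    (h : HasCompactSupport φ) : C₀(X, 𝕜) where
  toFun x := (φ x : 𝕜)
  continuous_toFun := by fun_prop
  zero_at_infty' := (h.comp_left (g := fun r : ℝ => (r : 𝕜)) (by simp)).is_zero_at_infty

theorem ofCompactSupport_apply (φ : C(X, ℝ)) (h : HasCompactSupport φ) (x : X) :
    ofCompactSupport 𝕜 φ h x = (φ x : 𝕜) := rfl

/-- The cut-off function that is `1` on the closed ball of radius `r` about `x` and
vanishes outside the ball of radius `r + 1`. -/
noncomputable def cutoff {X : Type*} [MetricSpace X] (x : X) (r : ℝ) : C(X, ℝ) where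
  toFun z := max 0 (min 1 (r + 1 - dist z x))
  continuous_toFun := by fun_prop

theorem cutoff_eq_one {x z : X} {r : ℝ} (h : dist z x ≤ r) : cutoff x r z = 1 := by
  change max 0 (min 1 (r + 1 - dist z x)) = 1
  rw [min_eq_left (by linarith), max_eq_right zero_le_one]

theorem cutoff_mem (x z : X) (r : ℝ) : 0 ≤ cutoff x r z ∧ cutoff x r z ≤ 1 :=
  ⟨le_max_left _ _, max_le zero_le_one (min_le_left _ _)⟩

theorem tsupport_cutoff (x : X) (r : ℝ) :
    tsupport (cutoff x r) ⊆ Metric.closedBall x (r + 1) := by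
  refine closure_minimal (fun z hz => ?_) Metric.isClosed_closedBall
  by_contra hn
  rw [Metric.mem_closedBall, not_le] at hn
  refine hz ?_
  change max 0 (min 1 (r + 1 - dist z x)) = 0
  exact max_eq_left ((min_le_right _ _).trans (by linarith))

theorem hasCompactSupport_cutoff [ProperSpace X] (x : X) (r : ℝ) :
    HasCompactSupport (cutoff x r) :=
  (isCompact_closedBall x (r + 1)).of_isClosed_subset (isClosed_tsupport _) (tsupport_cutoff x r)

theorem exists_cutoff_norm_sub_le [ProperSpace X] (x : X) (g : C₀(X, 𝕜)) {ε : ℝ} (hε : 0 < ε) :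
    ∃ r : ℝ, ‖g - ofCompactSupport 𝕜 (cutoff x r) (hasCompactSupport_cutoff x r) * g‖ ≤ ε := by
  have h1 := (zero_at_infty g).eventually (Metric.ball_mem_nhds 0 hε)
  obtain ⟨K, hK, hKg⟩ := Filter.mem_cocompact.1 h1
  obtain ⟨r, hr⟩ := hK.isBounded.subset_closedBall x
  refine ⟨r, ?_⟩
  rw [← ZeroAtInftyContinuousMap.norm_toBCF_eq_norm, BoundedContinuousFunction.norm_le hε.le]
  intro z
  change ‖g z - (cutoff x r z : 𝕜) * g z‖ ≤ ε
  by_cases hz : z ∈ K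
  · rw [cutoff_eq_one (hr hz)]
    simpa using hε.le
  · have h2 : ‖g z‖ < ε := by simpa using hKg hz
    have h3 := cutoff_mem x z r
    have : g z - (cutoff x r z : 𝕜) * g z = ((1 - cutoff x r z : ℝ) : 𝕜) * g z := by
      push_cast; ring
    rw [this, norm_mul, RCLike.norm_ofReal, abs_of_nonneg (by linarith)]
    nlinarith [norm_nonneg (g z)]

/-- A local vanishing condition on a finite open cover of the support of `g` suffices. -/
theorem eq_zero_of_cover [ProperSpace X] {E : Type*} [AddCommGroup E] (L : C₀(X, 𝕜) →+ E)
    (g : C₀(X, 𝕜)) (hg : HasCompactSupport g) (t : Finset X) (V : X → Set X)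
    (hV : ∀ y ∈ t, IsOpen (V y)) (hcov : tsupport g ⊆ ⋃ y ∈ t, V y)
    (hL : ∀ y ∈ t, ∀ g' : C₀(X, 𝕜), (∀ z ∉ V y, g' z = 0) → L g' = 0) : L g = 0 := by
  let e := t.equivFin.symm
  obtain ⟨p, hp1, hp2, -, hp4⟩ := exists_continuous_sum_one_of_isOpen_isCompact
    (s := fun i => V (e i)) (t := tsupport g) (fun i => hV _ (e i).2) hg (by
      intro z hz
      obtain ⟨y, hy, hzy⟩ := Set.mem_iUnion₂.1 (hcov hz)
      exact Set.mem_iUnion.2 ⟨e.symm ⟨y, hy⟩, by simpa using hzy⟩)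
  have hsum : g = ∑ i, ofCompactSupport 𝕜 (p i) (hp4 i) * g := by
    ext z
    have h0 : (∑ i, ofCompactSupport 𝕜 (p i) (hp4 i) * g) z = ∑ i, (p i z : 𝕜) * g z := by
      let ev : C₀(X, 𝕜) →+ 𝕜 :=
        { toFun := fun k => k z
          map_zero' := rfl
          map_add' := fun _ _ => rfl }
      exact map_sum ev (fun i => ofCompactSupport 𝕜 (p i) (hp4 i) * g) Finset.univ
    rw [h0, ← Finset.sum_mul]
    by_cases hz : z ∈ tsupport g
    · have h1 := hp2 hz
      simp only [Finset.sum_apply, Pi.one_apply] at h1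
      have h2 : (∑ i, (p i z : 𝕜)) = 1 := by exact_mod_cast h1
      rw [h2, one_mul]
    · rw [image_eq_zero_of_notMem_tsupport hz, mul_zero]
  rw [hsum, map_sum]
  refine Finset.sum_eq_zero fun i _ => hL _ (e i).2 _ fun z hz => ?_
  change (p i z : 𝕜) * g z = 0
  rw [image_eq_zero_of_notMem_tsupport (fun h => hz (hp1 i h))]
  simp

theorem rep_mul_mul_rep_eq_zero [ProperSpace X] {T : H →L[𝕜] H} {R : ℝ}
    (hT : ∀ p ∈ opSupport ρ T, dist p.1 p.2 ≤ R) (f g : C₀(X, 𝕜)) (hf : HasCompactSupport f)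
    (hg : HasCompactSupport g) (hd : ∀ x ∈ tsupport f, ∀ y ∈ tsupport g, R < dist x y) :
    ρ f * T * ρ g = 0 := by
  have hloc : ∀ x ∈ tsupport f, ∃ U : Set X, IsOpen U ∧ x ∈ U ∧
      ∀ f' : C₀(X, 𝕜), (∀ z ∉ U, f' z = 0) → ρ f' * T * ρ g = 0 := by
    intro x hx
    have hxy : ∀ y ∈ tsupport g, ∃ U V : Set X, IsOpen U ∧ x ∈ U ∧ IsOpen V ∧ y ∈ V ∧
        ∀ f g : C₀(X, 𝕜), (∀ z ∉ U, f z = 0) → (∀ z ∉ V, g z = 0) → ρ f * T * ρ g = 0 := by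
      intro y hy
      by_contra hn
      exact absurd (hT (x, y) hn) (not_le.2 (hd x hx y hy))
    choose! U V hU hxU hV hyV hUV using hxy
    obtain ⟨t, htg, htc⟩ := hg.elim_nhds_subcover V (fun y hy => (hV y hy).mem_nhds (hyV y hy))
    refine ⟨⋂ y ∈ t, U y, isOpen_biInter_finset fun y hy => hU y (htg y hy),
      Set.mem_iInter₂.2 fun y hy => hxU y (htg y hy), fun f' hf' => ?_⟩
    let L : C₀(X, 𝕜) →+ (H →L[𝕜] H) :=
      { toFun := fun g' => ρ f' * T * ρ g'
        map_zero' := by rw [map_zero, mul_zero]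
        map_add' := fun a b => by rw [map_add, mul_add] }
    refine eq_zero_of_cover L g hg t V (fun y hy => hV y (htg y hy)) htc
      fun y hy g' hg' => hUV y (htg y hy) f' g' (fun z hz => hf' z fun h => hz ?_) hg'
    exact Set.mem_iInter₂.1 h y hy
  choose! U hU hxU hUf using hloc
  obtain ⟨t, htf, htc⟩ := hf.elim_nhds_subcover U (fun x hx => (hU x hx).mem_nhds (hxU x hx))
  let L : C₀(X, 𝕜) →+ (H →L[𝕜] H) :=
    { toFun := fun f' => ρ f' * T * ρ g
      map_zero' := by rw [map_zero, zero_mul, zero_mul]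
      map_add' := fun a b => by rw [map_add, add_mul, add_mul] }
  exact eq_zero_of_cover L f hf t U (fun x hx => hU x (htf x hx)) htc
    fun x hx f' hf' => hUf x (htf x hx) f' hf'

theorem tsupport_subset_closedBall {x : X} {r : ℝ} {f : C₀(X, 𝕜)}
    (hf : ∀ z ∉ Metric.ball x r, f z = 0) : tsupport f ⊆ Metric.closedBall x r := by
  refine closure_minimal (fun z hz => ?_) Metric.isClosed_closedBall
  by_contra hn
  exact hz (hf z fun h => hn (Metric.ball_subset_closedBall h))

/-- If `T` is `R`-controlled and `f` lives on the unit ball about `x`, then `ρ f ∘ T` only sees a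
bounded neighbourhood of `x`. -/
theorem rep_mul_eq_mul_cutoff [ProperSpace X] (hρ : Nondegenerate ρ) {T : H →L[𝕜] H} {R : ℝ}
    (hT : ∀ p ∈ opSupport ρ T, dist p.1 p.2 ≤ R) {x : X} {f : C₀(X, 𝕜)}
    (hf : ∀ z ∉ Metric.ball x 1, f z = 0) :
    ρ f * T =
      ρ f * T * ρ (ofCompactSupport 𝕜 (cutoff x (R + 2)) (hasCompactSupport_cutoff x _)) := by
  set h := ofCompactSupport 𝕜 (cutoff x (R + 2)) (hasCompactSupport_cutoff x _) with hh
  have hfs := tsupport_subset_closedBall hf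
  have hfc : HasCompactSupport f :=
    (isCompact_closedBall x 1).of_isClosed_subset (isClosed_tsupport _) hfs
  have hkill : ∀ g : C₀(X, 𝕜), ρ f * T * ρ (g - h * g) = 0 := by
    intro g
    by_contra hne
    have hpos : 0 < ‖ρ f * T * ρ (g - h * g)‖ := norm_pos_iff.2 hne
    set C := ‖ρ f * T‖ with hC
    have hC0 : 0 ≤ C := norm_nonneg _
    set δ := ‖ρ f * T * ρ (g - h * g)‖ with hδ
    obtain ⟨r, hr⟩ := exists_cutoff_norm_sub_le x (g - h * g)
      (show 0 < δ / (2 * (C + 1)) by positivity)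
    set χ := ofCompactSupport 𝕜 (cutoff x r) (hasCompactSupport_cutoff x r) with hχ
    have hsupp : tsupport (χ * (g - h * g) : C₀(X, 𝕜)) ⊆ (Metric.ball x (R + 2))ᶜ := by
      refine closure_minimal (fun z hz hzb => hz ?_) Metric.isOpen_ball.isClosed_compl
      change (cutoff x r z : 𝕜) * (g z - (cutoff x (R + 2) z : 𝕜) * g z) = 0
      rw [cutoff_eq_one (Metric.mem_ball.1 hzb).le]
      simp
    have hcs : HasCompactSupport (χ * (g - h * g) : C₀(X, 𝕜)) := by
      refine HasCompactSupport.intro (isCompact_closedBall x (r + 1)) fun z hz => ?_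
      change (cutoff x r z : 𝕜) * (g z - (cutoff x (R + 2) z : 𝕜) * g z) = 0
      rw [image_eq_zero_of_notMem_tsupport fun hz' => hz (tsupport_cutoff x r hz')]
      simp
    have h0 : ρ f * T * ρ (χ * (g - h * g)) = 0 := by
      refine rep_mul_mul_rep_eq_zero hT f _ hfc hcs fun a ha b hb => ?_
      have h1 := Metric.mem_closedBall.1 (hfs ha)
      have h2 := hsupp hb
      rw [Set.mem_compl_iff, Metric.mem_ball, not_lt] at h2
      linarith [dist_triangle_left b x a]
    have h1 : ρ f * T * ρ (g - h * g)
        = ρ f * T * ρ ((g - h * g) - χ * (g - h * g)) := by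
      rw [map_sub ρ (g - h * g), mul_sub, h0, sub_zero]
    have h2 : ‖ρ ((g - h * g) - χ * (g - h * g))‖ ≤ δ / (2 * (C + 1)) :=
      ContinuousLinearMap.opNorm_le_bound _ (by positivity) fun v =>
        (norm_rep_apply_le _ v).trans (by gcongr)
    have h3 : δ ≤ C * (δ / (2 * (C + 1))) := by
      calc δ = ‖ρ f * T * ρ ((g - h * g) - χ * (g - h * g))‖ := by rw [hδ, h1]
        _ ≤ C * ‖ρ ((g - h * g) - χ * (g - h * g))‖ := norm_mul_le _ _
        _ ≤ C * (δ / (2 * (C + 1))) := by gcongr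
    have h4 : C * (δ / (2 * (C + 1))) < δ := by
      rw [mul_div_assoc', div_lt_iff₀ (by positivity)]
      nlinarith
    linarith
  have hdense : Dense (Submodule.span 𝕜 {w : H | ∃ (f : C₀(X, 𝕜)) (v : H), ρ f v = w} : Set H) := hρ
  refine ContinuousLinearMap.ext_on hdense ?_
  rintro _ ⟨g, v, rfl⟩
  have := congrArg (fun S : H →L[𝕜] H => S v) (hkill g)
  simp only [map_sub, map_mul, mul_sub, sub_apply,
    zero_apply] at this
  exact sub_eq_zero.1 this

theorem Controlled.add {S T : H →L[𝕜] H} (hS : Controlled ρ S) (hT : Controlled ρ T) :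
    Controlled ρ (S + T) := by
  obtain ⟨R, hR, hS⟩ := hS
  obtain ⟨R', hR', hT⟩ := hT
  refine ⟨max R R', lt_max_of_lt_left hR, fun p hp => ?_⟩
  by_contra hn
  rw [not_le, max_lt_iff] at hn
  have h1 : p ∉ opSupport ρ S := fun h => absurd (hS p h) (not_le.2 hn.1)
  have h2 : p ∉ opSupport ρ T := fun h => absurd (hT p h) (not_le.2 hn.2)
  obtain ⟨U, V, hU, hpU, hV, hpV, h1⟩ := not_not.1 h1
  obtain ⟨U', V', hU', hpU', hV', hpV', h2⟩ := not_not.1 h2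
  refine hp ⟨U ∩ U', V ∩ V', hU.inter hU', ⟨hpU, hpU'⟩, hV.inter hV', ⟨hpV, hpV'⟩,
    fun f g hf hg => ?_⟩
  rw [mul_add, add_mul, h1 f g (fun x hx => hf x fun h => hx h.1) (fun x hx => hg x fun h => hx h.1),
    h2 f g (fun x hx => hf x fun h => hx h.2) (fun x hx => hg x fun h => hx h.2), add_zero]

theorem Controlled.smul {T : H →L[𝕜] H} (c : 𝕜) (hT : Controlled ρ T) : Controlled ρ (c • T) := by
  obtain ⟨R, hR, hT⟩ := hT
  refine ⟨R, hR, fun p hp => hT p fun ⟨U, V, hU, hpU, hV, hpV, h⟩ =>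
    hp ⟨U, V, hU, hpU, hV, hpV, fun f g hf hg => ?_⟩⟩
  rw [mul_smul_comm, smul_mul_assoc, h f g hf hg, smul_zero]

theorem controlled_zero : Controlled ρ 0 :=
  ⟨1, one_pos, fun p hp => absurd ⟨Set.univ, Set.univ, isOpen_univ, trivial, isOpen_univ, trivial,
    fun f g _ _ => by rw [mul_zero, zero_mul]⟩ hp⟩

theorem Controlled.star {T : H →L[𝕜] H} (hT : Controlled ρ T) : Controlled ρ (star T) := by
  obtain ⟨R, hR, hT⟩ := hT
  refine ⟨R, hR, fun p hp => ?_⟩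
  rw [dist_comm]
  refine hT (p.2, p.1) fun ⟨U, V, hU, hpU, hV, hpV, h⟩ =>
    hp ⟨V, U, hV, hpV, hU, hpU, fun f g hf hg => ?_⟩
  have h1 := h (Star.star g) (Star.star f)
    (fun x hx => by rw [ZeroAtInftyContinuousMap.star_apply, hg x hx, star_zero])
    (fun x hx => by rw [ZeroAtInftyContinuousMap.star_apply, hf x hx, star_zero])
  have h2 := congrArg Star.star h1
  simpa [star_mul, mul_assoc, map_star] using h2

theorem Controlled.mul [ProperSpace X] (hρ : Nondegenerate ρ) {S T : H →L[𝕜] H}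
    (hS : Controlled ρ S) (hT : Controlled ρ T) : Controlled ρ (S * T) := by
  obtain ⟨R, hR, hS⟩ := hS
  obtain ⟨R', hR', hT⟩ := hT
  refine ⟨R + R' + 4, by positivity, fun p hp => ?_⟩
  by_contra hn
  rw [not_le] at hn
  refine hp ⟨Metric.ball p.1 1, Metric.ball p.2 1, Metric.isOpen_ball,
    Metric.mem_ball_self one_pos, Metric.isOpen_ball, Metric.mem_ball_self one_pos,
    fun f g hf hg => ?_⟩
  set h := ofCompactSupport 𝕜 (cutoff p.1 (R + 2)) (hasCompactSupport_cutoff p.1 _) with hh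
  have hhs : tsupport h ⊆ Metric.closedBall p.1 (R + 2 + 1) := by
    refine closure_minimal (fun z hz => ?_) Metric.isClosed_closedBall
    by_contra hn
    refine hz ?_
    change (cutoff p.1 (R + 2) z : 𝕜) = 0
    rw [image_eq_zero_of_notMem_tsupport fun hz' => hn (tsupport_cutoff p.1 _ hz')]
    simp
  have hgs := tsupport_subset_closedBall hg
  have h0 : ρ h * T * ρ g = 0 := by
    refine rep_mul_mul_rep_eq_zero hT h g
      ((isCompact_closedBall _ _).of_isClosed_subset (isClosed_tsupport _) hhs)
      ((isCompact_closedBall _ _).of_isClosed_subset (isClosed_tsupport _) hgs)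
      fun a ha b hb => ?_
    have h1 := Metric.mem_closedBall.1 (hhs ha)
    have h2 := Metric.mem_closedBall.1 (hgs hb)
    have h3 := dist_triangle4 p.1 a b p.2
    rw [dist_comm p.1 a] at h3
    linarith
  calc ρ f * (S * T) * ρ g = (ρ f * S) * T * ρ g := by simp only [mul_assoc]
    _ = (ρ f * S * ρ h) * T * ρ g := by rw [← rep_mul_eq_mul_cutoff hρ hS hf]
    _ = ρ f * S * (ρ h * T * ρ g) := by simp only [mul_assoc]
    _ = 0 := by rw [h0, mul_zero]

/-- The `*`-algebra of locally compact, controlled operators. -/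
def locallyCompactControlledAlgebra [ProperSpace X] (hρ : Nondegenerate ρ) :
    NonUnitalStarSubalgebra 𝕜 (H →L[𝕜] H) where
  carrier := locallyCompactControlled ρ
  add_mem' {S T} hS hT := ⟨fun f => ⟨by
      rw [mul_add]; exact (hS.1 f).1.add (hT.1 f).1, by
      rw [add_mul]; exact (hS.1 f).2.add (hT.1 f).2⟩, hS.2.add hT.2⟩
  zero_mem' := ⟨fun f => ⟨by rw [mul_zero]; exact isCompactOperator_zero, by
      rw [zero_mul]; exact isCompactOperator_zero⟩, controlled_zero⟩
  mul_mem' {S T} hS hT := ⟨fun f => ⟨by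
      rw [← mul_assoc]; exact (hS.1 f).1.comp_clm T, by
      rw [mul_assoc]; exact (hT.1 f).2.clm_comp S⟩, hS.2.mul hρ hT.2⟩
  smul_mem' c T hT := ⟨fun f => ⟨by
      rw [mul_smul_comm]; exact (hT.1 f).1.smul c, by
      rw [smul_mul_assoc]; exact (hT.1 f).2.smul c⟩, hT.2.smul c⟩
  star_mem' {T} hT := ⟨fun f => ⟨by
      have := isCompactOperator_adjoint (hT.1 (star f)).2
      rwa [star_mul, ← map_star, star_star] at this, by
      have := isCompactOperator_adjoint (hT.1 (star f)).1
      rwa [star_mul, ← map_star, star_star] at this⟩, hT.2.star⟩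

theorem coe_adjoin_locallyCompactControlled [ProperSpace X] (hρ : Nondegenerate ρ) :
    (NonUnitalStarAlgebra.adjoin 𝕜 (locallyCompactControlled ρ) : Set (H →L[𝕜] H))
      = locallyCompactControlled ρ :=
  Set.Subset.antisymm
    (NonUnitalStarAlgebra.adjoin_le (S := locallyCompactControlledAlgebra hρ) subset_rfl)
    (NonUnitalStarAlgebra.subset_adjoin 𝕜 _)

theorem coe_roeAlgebra [ProperSpace X] (hρ : Nondegenerate ρ) :
    (roeAlgebra ρ : Set (H →L[𝕜] H)) = closure (locallyCompactControlled ρ) := by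
  rw [← coe_adjoin_locallyCompactControlled hρ]
  rfl

end StarAlgebra

end RoeAlg

/-!
A unitary that matches the locally compact, controlled operators of two representations matches
the norm closures, so it suffices to describe these operators by data that two coarsely equivalent
spaces share. The data is an orthogonal decomposition of the Hilbert space, indexed by a separated
net in the space, into infinite-dimensional closed subspaces `G i` that are invariant under `C₀(X)`
and live on balls of a fixed radius about the points `p i` of the net (`IsLocalizedDecomposition`).
With respect to such a decomposition, `T` is controlled if and only if its matrix entry at `(i, j)`
vanishes when `p i` and `p j` are far apart (`IsLocalizedDecomposition.controlled_iff`), and `T` is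
locally compact if and only if its compositions with the projections onto the `G i` are compact
(`IsLocalizedDecomposition.locallyCompactOp_iff`).

Decompositions exist for every ample nondegenerate representation
(`exists_isLocalizedDecomposition`). Instead of the spectral projections of a Borel partition, the
proof only uses the spectral subspaces of open sets, that is, the closed spans of
`ρ(C₀(V)) H`. Cover `X` by open cells of bounded diameter, one for each point of the net, number
them, and let `G i` be the orthogonal complement of the spectral subspace of the union of the
earlier cells inside the spectral subspace of the union with the `i`th cell added. A cell contains
the unit ball about its point, and this ball misses all other cells, so `G i` is
infinite-dimensional by ampleness.

Two spaces `A` and `B` that are coarsely dense in a common space admit nets with the same index set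
whose distances differ by a bounded amount. All pieces of both decompositions are
infinite-dimensional separable Hilbert spaces. Hence some unitary matches the two decompositions
(`exists_unitary_map_eq`), and it matches the controlled and the locally compact operators
(`conj_mem_locallyCompactControlled`, `unitarilyIsomorphic_roeAlgebra`). The lattice `ℤᵈ` and the
Delone sets are closed and coarsely dense in `ℝᵈ`, which is used as the common space.
-/

namespace RoeAlg

/-! ### Representations of `C₀(X)` -/

section Representation

variable {𝕜 X H : Type*} [RCLike 𝕜] [MetricSpace X]
    [NormedAddCommGroup H] [InnerProductSpace 𝕜 H] [CompleteSpace H]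
    {ρ : C₀(X, 𝕜) →⋆ₙₐ[𝕜] (H →L[𝕜] H)}

theorem rep_mul_apply (f g : C₀(X, 𝕜)) (v : H) : ρ (f * g) v = ρ f (ρ g v) := by
  rw [map_mul]; rfl

theorem inner_rep_left (f : C₀(X, 𝕜)) (u v : H) :
    inner 𝕜 (ρ f u) v = inner 𝕜 u (ρ (star f) v) := by
  rw [map_star, ContinuousLinearMap.star_eq_adjoint, ContinuousLinearMap.adjoint_inner_right]

theorem inner_rep_right (f : C₀(X, 𝕜)) (u v : H) :
    inner 𝕜 u (ρ f v) = inner 𝕜 (ρ (star f) u) v := by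
  rw [inner_rep_left, star_star]

theorem star_apply_eq_zero {f : C₀(X, 𝕜)} {x : X} (h : f x = 0) : (star f) x = 0 := by
  rw [ZeroAtInftyContinuousMap.star_apply, h, star_zero]

theorem star_ofCompactSupport (φ : C(X, ℝ)) (h : HasCompactSupport φ) :
    star (ofCompactSupport 𝕜 φ h) = ofCompactSupport 𝕜 φ h := by
  ext x
  rw [ZeroAtInftyContinuousMap.star_apply, ofCompactSupport_apply]
  simp

theorem Nondegenerate.eq_zero_of_forall_inner (hρ : Nondegenerate ρ) {v : H}
    (h : ∀ (f : C₀(X, 𝕜)) (w : H), inner 𝕜 (ρ f w) v = 0) : v = 0 := by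
  refine Dense.eq_zero_of_inner_right 𝕜 hρ fun u hu => ?_
  have hle : Submodule.span 𝕜 {w : H | ∃ (f : C₀(X, 𝕜)) (v : H), ρ f v = w} ≤ (𝕜 ∙ v)ᗮ := by
    rw [Submodule.span_le]
    rintro _ ⟨f, w, rfl⟩
    exact Submodule.mem_orthogonal_singleton_iff_inner_left.2 (h f w)
  exact Submodule.mem_orthogonal_singleton_iff_inner_left.1 (hle hu)

theorem Nondegenerate.eq_zero_of_forall_rep (hρ : Nondegenerate ρ) {v : H}
    (h : ∀ f : C₀(X, 𝕜), ρ f v = 0) : v = 0 :=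
  hρ.eq_zero_of_forall_inner fun f w => by rw [inner_rep_left, h, inner_zero_right]

theorem continuous_rep : Continuous ρ := by
  have hle : ∀ f : C₀(X, 𝕜), ‖ρ f‖ ≤ 1 * ‖f‖ := fun f =>
    ContinuousLinearMap.opNorm_le_bound _ (by positivity) fun v => by
      simpa using norm_rep_apply_le f v
  exact AddMonoidHomClass.continuous_of_bound ρ 1 hle

/-- Functions of compact support are dense in `C₀(X)`, so a closed condition on `ρ f` need only be
checked for those. -/
theorem rep_mem_of_hasCompactSupport [ProperSpace X] {S : Set (H →L[𝕜] H)} (hS : IsClosed S)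
    (h : ∀ g : C₀(X, 𝕜), HasCompactSupport g → ρ g ∈ S) (f : C₀(X, 𝕜)) : ρ f ∈ S := by
  rcases isEmpty_or_nonempty X with hX | ⟨⟨x⟩⟩
  · exact h f (HasCompactSupport.intro isCompact_empty fun y => hX.elim y)
  refine (hS.preimage continuous_rep).closure_subset (s := ρ ⁻¹' S) ?_
  rw [Metric.mem_closure_iff]
  intro ε hε
  obtain ⟨r, hr⟩ := exists_cutoff_norm_sub_le x f (half_pos hε)
  refine ⟨_, h _ ?_, (dist_eq_norm _ _).trans_lt (hr.trans_lt (half_lt_self hε))⟩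
  refine HasCompactSupport.intro (isCompact_closedBall x (r + 1)) fun z hz => ?_
  change (cutoff x r z : 𝕜) * f z = 0
  rw [image_eq_zero_of_notMem_tsupport fun hz' => hz (tsupport_cutoff x r hz')]
  simp

/-! ### Spectral subspaces of open sets -/

/-- The closed linear span of the vectors `ρ f v`, where `f` vanishes outside `V`. For open `V`
this is the range of the spectral projection of `V`. -/
def spectralSubspace (ρ : C₀(X, 𝕜) →⋆ₙₐ[𝕜] (H →L[𝕜] H)) (V : Set X) : Submodule 𝕜 H :=
  (Submodule.span 𝕜 {w : H | ∃ (f : C₀(X, 𝕜)) (v : H),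
    (∀ x ∉ V, f x = 0) ∧ ρ f v = w}).topologicalClosure

theorem isClosed_spectralSubspace (V : Set X) : IsClosed (spectralSubspace ρ V : Set H) :=
  Submodule.isClosed_topologicalClosure _

instance (V : Set X) : CompleteSpace (spectralSubspace ρ V) :=
  (isClosed_spectralSubspace V).completeSpace_coe

theorem rep_mem_spectralSubspace {V : Set X} {f : C₀(X, 𝕜)} (hf : ∀ x ∉ V, f x = 0) (v : H) :
    ρ f v ∈ spectralSubspace ρ V :=
  Submodule.le_topologicalClosure _ (Submodule.subset_span ⟨f, v, hf, rfl⟩)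

/-- To map a spectral subspace into a closed subspace, it is enough to map its generators there. -/
theorem map_mem_of_mem_spectralSubspace {V : Set X} {W : Submodule 𝕜 H}
    (hW : IsClosed (W : Set H)) (L : H →L[𝕜] H)
    (h : ∀ f : C₀(X, 𝕜), (∀ x ∉ V, f x = 0) → ∀ v, L (ρ f v) ∈ W) {u : H}
    (hu : u ∈ spectralSubspace ρ V) : L u ∈ W := by
  have hle : spectralSubspace ρ V ≤ W.comap (L : H →ₗ[𝕜] H) := by
    refine Submodule.topologicalClosure_minimal _ ?_ (hW.preimage L.continuous)
    rw [Submodule.span_le]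
    rintro _ ⟨f, v, hf, rfl⟩
    exact h f hf v
  exact hle hu

theorem spectralSubspace_mono {V W : Set X} (h : V ⊆ W) :
    spectralSubspace ρ V ≤ spectralSubspace ρ W := fun _ hu =>
  map_mem_of_mem_spectralSubspace (isClosed_spectralSubspace W) (ContinuousLinearMap.id 𝕜 H)
    (fun _ hf v => rep_mem_spectralSubspace (fun x hx => hf x fun hx' => hx (h hx')) v) hu

theorem spectralSubspace_empty : spectralSubspace ρ (∅ : Set X) = ⊥ := by
  refine eq_bot_iff.2 fun u hu => ?_
  refine map_mem_of_mem_spectralSubspace (W := ⊥) (by simp)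
    (ContinuousLinearMap.id 𝕜 H) (fun f hf v => ?_) hu
  have : f = 0 := by ext x; exact hf x (Set.notMem_empty x)
  simp [this]

theorem rep_apply_mem_spectralSubspace {V : Set X} (f : C₀(X, 𝕜)) {u : H}
    (hu : u ∈ spectralSubspace ρ V) : ρ f u ∈ spectralSubspace ρ V := by
  refine map_mem_of_mem_spectralSubspace (isClosed_spectralSubspace V) _ (fun g hg v => ?_) hu
  rw [← rep_mul_apply]
  refine rep_mem_spectralSubspace (fun x hx => ?_) v
  rw [ZeroAtInftyContinuousMap.mul_apply, hg x hx, mul_zero]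

/-- The image of `ρ` is closed under adjoints, so complements of invariant subspaces are
invariant. -/
theorem rep_apply_mem_orthogonal {W : Submodule 𝕜 H}
    (hW : ∀ (f : C₀(X, 𝕜)), ∀ u ∈ W, ρ f u ∈ W) (f : C₀(X, 𝕜)) {u : H} (hu : u ∈ Wᗮ) :
    ρ f u ∈ Wᗮ := by
  rw [Submodule.mem_orthogonal] at hu ⊢
  intro w hw
  rw [inner_rep_right]
  exact hu _ (hW _ w hw)

end Representation

/-! ### Localized decompositions -/

/-- An orthogonal decomposition of `H` into infinite-dimensional closed subspaces `G i`, invariant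
under `C₀(X)`, such that `G i` lives on the ball of radius `r` about `p i`: a function vanishing on
this ball acts by zero on `G i`. -/
structure IsLocalizedDecomposition {𝕜 X H ι : Type*} [RCLike 𝕜] [MetricSpace X]
    [NormedAddCommGroup H] [InnerProductSpace 𝕜 H] [CompleteSpace H]
    (ρ : C₀(X, 𝕜) →⋆ₙₐ[𝕜] (H →L[𝕜] H)) (p : ι → X) (r : ℝ) (G : ι → Submodule 𝕜 H) : Prop where
  isClosed : ∀ i, IsClosed (G i : Set H)
  isOrtho : ∀ i j, i ≠ j → G i ⟂ G j
  total : (⨆ i, G i)ᗮ = ⊥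
  invariant : ∀ (i : ι) (f : C₀(X, 𝕜)), ∀ u ∈ G i, ρ f u ∈ G i
  localized : ∀ (i : ι) (f : C₀(X, 𝕜)), (∀ x ∈ Metric.ball (p i) r, f x = 0) →
    ∀ u ∈ G i, ρ f u = 0
  infinite : ∀ i, ¬ FiniteDimensional 𝕜 (G i)

section Decomposition

variable {𝕜 X H ι : Type*} [RCLike 𝕜] [MetricSpace X]
    [NormedAddCommGroup H] [InnerProductSpace 𝕜 H] [CompleteSpace H]
    {ρ : C₀(X, 𝕜) →⋆ₙₐ[𝕜] (H →L[𝕜] H)}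

/-- The open sets used to cut `H` into pieces: the part of a ball of radius `r` about `p i` that
stays away from the balls of radius `2` about the other points. -/
def cell (p : ι → X) (r : ℝ) (i : ι) : Set X :=
  Metric.ball (p i) r \ closure (⋃ j ≠ i, Metric.ball (p j) 2)

theorem isOpen_cell (p : ι → X) (r : ℝ) (i : ι) : IsOpen (cell p r i) :=
  Metric.isOpen_ball.sdiff isClosed_closure

theorem mem_cell {p : ι → X} {r : ℝ} {i : ι} {x : X} (h : dist x (p i) < r)
    (h' : ∀ j ≠ i, 3 ≤ dist x (p j)) : x ∈ cell p r i := by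
  refine ⟨h, fun hx => ?_⟩
  obtain ⟨y, hy, hxy⟩ := Metric.mem_closure_iff.1 hx 1 one_pos
  obtain ⟨j, hj, hyj⟩ := Set.mem_iUnion₂.1 hy
  have h1 := h' j hj
  have h2 := Metric.mem_ball.1 hyj
  linarith [dist_triangle x y (p j)]

/-- The union of the cells whose number, in a numbering `e` of the index set, is below `n`. -/
def cellUnion (p : ι → X) (r : ℝ) (e : ι → ℕ) (n : ℕ) : Set X :=
  ⋃ i, ⋃ (_ : e i < n), cell p r i

theorem mem_cellUnion {p : ι → X} {r : ℝ} {e : ι → ℕ} {n : ℕ} {x : X} :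
    x ∈ cellUnion p r e n ↔ ∃ i, e i < n ∧ x ∈ cell p r i := by
  simp [cellUnion]

theorem cellUnion_mono (p : ι → X) (r : ℝ) (e : ι → ℕ) : Monotone (cellUnion p r e) := by
  intro m n hmn x hx
  obtain ⟨i, hi, hx⟩ := mem_cellUnion.1 hx
  exact mem_cellUnion.2 ⟨i, hi.trans_le hmn, hx⟩

/-- The cells cover the space: a point within distance `4` of some `p i` lies in the `i`th cell,
because it is far from the other points, and any other point lies in the cell of each sufficiently
close `p i`. -/
theorem exists_mem_cellUnion {p : ι → X} {C r : ℝ} (hC : C < r) (hr : 4 ≤ r)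
    (hsep : ∀ i j, i ≠ j → 8 ≤ dist (p i) (p j)) (hcov : ∀ x, ∃ i, dist x (p i) ≤ C)
    (e : ι → ℕ) (x : X) : ∃ n, x ∈ cellUnion p r e n := by
  suffices ∃ i, x ∈ cell p r i by
    obtain ⟨i, hi⟩ := this
    exact ⟨e i + 1, mem_cellUnion.2 ⟨i, Nat.lt_succ_self _, hi⟩⟩
  by_cases h : ∃ i, dist x (p i) < 4
  · obtain ⟨i, hi⟩ := h
    refine ⟨i, mem_cell (by linarith) fun j hj => ?_⟩
    linarith [hsep j i hj, dist_triangle_left (p j) (p i) x]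
  · push Not at h
    obtain ⟨i, hi⟩ := hcov x
    exact ⟨i, mem_cell (by linarith) fun j _ => by linarith [h j]⟩

/-- The part of `H` that lives on the `i`th cell minus the cells with smaller number. -/
def cellSubspace (ρ : C₀(X, 𝕜) →⋆ₙₐ[𝕜] (H →L[𝕜] H)) (p : ι → X) (r : ℝ) (e : ι → ℕ) (i : ι) :
    Submodule 𝕜 H :=
  spectralSubspace ρ (cellUnion p r e (e i + 1)) ⊓ (spectralSubspace ρ (cellUnion p r e (e i)))ᗮ

/-- By induction on `n`, a vector orthogonal to all pieces is orthogonal to the spectral subspace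
of the union of the first `n` cells. Every compact set is contained in such a union. -/
theorem iSup_cellSubspace_orthogonal [ProperSpace X] (hρ : Nondegenerate ρ) {p : ι → X} {C r : ℝ}
    (hC : C < r) (hr : 4 ≤ r) (hsep : ∀ i j, i ≠ j → 8 ≤ dist (p i) (p j))
    (hcov : ∀ x, ∃ i, dist x (p i) ≤ C) (e : ι → ℕ) :
    (⨆ i, cellSubspace ρ p r e i)ᗮ = ⊥ := by
  refine eq_bot_iff.2 fun v hv => ?_
  have hv' : ∀ i, ∀ u ∈ cellSubspace ρ p r e i, inner 𝕜 u v = 0 := fun i u hu =>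
    (Submodule.mem_orthogonal _ _).1 hv u (Submodule.mem_iSup_of_mem i hu)
  have hn : ∀ n, ∀ u ∈ spectralSubspace ρ (cellUnion p r e n), inner 𝕜 u v = 0 := by
    intro n
    induction n with
    | zero =>
      intro u hu
      have : cellUnion p r e 0 = ∅ := by simp [cellUnion]
      rw [this, spectralSubspace_empty, Submodule.mem_bot] at hu
      rw [hu, inner_zero_left]
    | succ n ih =>
      intro u hu
      by_cases hi : ∃ i, e i = n
      · obtain ⟨i, rfl⟩ := hi
        set W := spectralSubspace ρ (cellUnion p r e (e i)) with hWdef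
        have h1 : u - W.starProjection u ∈ cellSubspace ρ p r e i :=
          ⟨Submodule.sub_mem _ hu (spectralSubspace_mono (cellUnion_mono p r e (Nat.le_succ _))
            (W.starProjection_apply_mem u)), W.sub_starProjection_mem_orthogonal u⟩
        have h2 := hv' i _ h1
        rwa [inner_sub_left, ih _ (W.starProjection_apply_mem u), sub_zero] at h2
      · refine ih u (spectralSubspace_mono (fun x hx => ?_) hu)
        obtain ⟨i, hin, hx⟩ := mem_cellUnion.1 hx
        exact mem_cellUnion.2 ⟨i, lt_of_le_of_ne (Nat.lt_succ_iff.1 hin) fun h => hi ⟨i, h⟩, hx⟩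
  refine hρ.eq_zero_of_forall_inner fun f w => ?_
  refine rep_mem_of_hasCompactSupport (S := {A : H →L[𝕜] H | inner 𝕜 (A w) v = 0})
    (isClosed_eq (by fun_prop) continuous_const) (fun g hg => ?_) f
  obtain ⟨n, hgn⟩ := hg.isCompact.elim_directed_cover (cellUnion p r e)
    (fun n => isOpen_iUnion fun i => isOpen_iUnion fun _ => isOpen_cell p r i)
    (fun x _ => Set.mem_iUnion.2 (exists_mem_cellUnion hC hr hsep hcov e x))
    (cellUnion_mono p r e).directed_le
  exact hn n _ (rep_mem_spectralSubspace
    (fun x hx => image_eq_zero_of_notMem_tsupport fun h => hx (hgn h)) w)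

/-- Functions on the unit ball about `p i` only act on the `i`th piece, which therefore is
infinite-dimensional by ampleness. -/
theorem not_finiteDimensional_cellSubspace [ProperSpace X] (hρ : Ample ρ) {p : ι → X} {r : ℝ}
    (hr : 4 ≤ r) (hsep : ∀ i j, i ≠ j → 8 ≤ dist (p i) (p j)) (e : ι → ℕ) (i : ι) : ¬ FiniteDimensional 𝕜 (cellSubspace ρ p r e i) := by
  intro hfin
  set f := ofCompactSupport 𝕜 (cutoff (p i) 0) (hasCompactSupport_cutoff (p i) 0) with hf
  have hf0 : ∀ x, 1 ≤ dist x (p i) → f x = 0 := by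
    intro x hx
    have : cutoff (p i) 0 x = 0 := max_eq_left ((min_le_right _ _).trans (by linarith))
    rw [hf, ofCompactSupport_apply, this, RCLike.ofReal_zero]
  have hf1 : f (p i) = 1 := by
    rw [hf, ofCompactSupport_apply, cutoff_eq_one (dist_self _).le, RCLike.ofReal_one]
  have hmem : ∀ v, ρ f v ∈ cellSubspace ρ p r e i := by
    intro v
    refine ⟨rep_mem_spectralSubspace (fun x hx => hf0 x ?_) v, ?_⟩
    · by_contra hlt
      push Not at hlt
      refine hx (mem_cellUnion.2 ⟨i, Nat.lt_succ_self _, mem_cell (by linarith) fun j hj => ?_⟩)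
      linarith [hsep j i hj, dist_triangle_left (p j) (p i) x]
    · refine (Submodule.mem_orthogonal' _ _).2 fun u hu => ?_
      rw [inner_rep_left]
      suffices ρ (star f) u = 0 by rw [this, inner_zero_right]
      refine (Submodule.mem_bot 𝕜).1
        (map_mem_of_mem_spectralSubspace (W := ⊥) (by simp) _ (fun g hg w => ?_) hu)
      have h0 : star f * g = 0 := by
        ext x
        rw [ZeroAtInftyContinuousMap.mul_apply]
        by_cases hx : 1 ≤ dist x (p i)
        · rw [star_apply_eq_zero (hf0 x hx), zero_mul]; rfl
        · rw [hg x, mul_zero]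
          · rfl
          intro hx'
          obtain ⟨j, hj, hxj⟩ := mem_cellUnion.1 hx'
          refine hxj.2 (subset_closure (Set.mem_iUnion₂.2 ⟨i, ?_, ?_⟩))
          · rintro rfl
            exact lt_irrefl _ hj
          · rw [Metric.mem_ball]
            linarith
      rw [← rep_mul_apply, h0, map_zero]
      exact Submodule.zero_mem _
  have hcomp : IsCompactOperator (ρ f) := by
    have h1 : IsCompactOperator ((ρ f).codRestrict (cellSubspace ρ p r e i) hmem) :=
      have := FiniteDimensional.proper 𝕜 (cellSubspace ρ p r e i)
      isCompactOperator_of_locallyCompactSpace_dom _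
    exact h1.clm_comp (cellSubspace ρ p r e i).subtypeL
  have h0 := hρ f hcomp
  rw [h0] at hf1
  exact zero_ne_one hf1

/-- The differences of the spectral subspaces of the increasing open sets `cellUnion p r e n`
play the role of the spectral subspaces of a Borel partition with bounded pieces. -/
theorem exists_isLocalizedDecomposition [ProperSpace X] [Countable ι] (hρ : Nondegenerate ρ)
    (hρ' : Ample ρ) {p : ι → X} (hsep : ∀ i j, i ≠ j → 8 ≤ dist (p i) (p j))
    {C : ℝ} (hcov : ∀ x, ∃ i, dist x (p i) ≤ C) :
    ∃ r, 0 < r ∧ ∃ G : ι → Submodule 𝕜 H, IsLocalizedDecomposition ρ p r G := by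
  obtain ⟨e, he⟩ := exists_injective_nat ι
  set r := max C 0 + 4 with hrdef
  have hC : C < r := by linarith [le_max_left C 0]
  have hr : 4 ≤ r := by linarith [le_max_right C 0]
  have hinv : ∀ (n : ℕ) (f : C₀(X, 𝕜)), ∀ u ∈ (spectralSubspace ρ (cellUnion p r e n))ᗮ,
      ρ f u ∈ (spectralSubspace ρ (cellUnion p r e n))ᗮ := fun n f u hu =>
    rep_apply_mem_orthogonal (fun f u hu => rep_apply_mem_spectralSubspace f hu) f hu
  refine ⟨r, by linarith, cellSubspace ρ p r e, ?_, ?_, ?_, ?_, ?_, ?_⟩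
  · exact fun i => (isClosed_spectralSubspace _).inter (Submodule.isClosed_orthogonal _)
  · -- a piece lies in the spectral subspace that every later piece is orthogonal to
    have hlt : ∀ i j, e i < e j → cellSubspace ρ p r e i ⟂ cellSubspace ρ p r e j := by
      intro i j hij
      refine (Submodule.isOrtho_orthogonal_right
        (spectralSubspace ρ (cellUnion p r e (e j)))).mono ?_ inf_le_right
      exact inf_le_left.trans (spectralSubspace_mono (cellUnion_mono p r e hij))
    intro i j hij
    rcases lt_or_gt_of_ne (fun h => hij (he h)) with h | h
    · exact hlt i j h
    · exact (hlt j i h).symm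
  · exact iSup_cellSubspace_orthogonal hρ hC hr hsep hcov e
  · exact fun i f u hu => ⟨rep_apply_mem_spectralSubspace f hu.1, hinv _ f u hu.2⟩
  · intro i f hf u hu
    -- multiplication by `f` pushes the `i`th piece into the span of the earlier cells, to which
    -- it stays orthogonal
    have h1 : ρ f u ∈ spectralSubspace ρ (cellUnion p r e (e i)) := by
      refine map_mem_of_mem_spectralSubspace (isClosed_spectralSubspace _) _ (fun g hg v => ?_) hu.1
      rw [← rep_mul_apply]
      refine rep_mem_spectralSubspace (fun x hx => ?_) v
      rw [ZeroAtInftyContinuousMap.mul_apply]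
      by_cases hxi : x ∈ cell p r i
      · rw [hf x hxi.1, zero_mul]
      · rw [hg x, mul_zero]
        intro hx'
        obtain ⟨j, hj, hxj⟩ := mem_cellUnion.1 hx'
        refine hx (mem_cellUnion.2 ⟨j, lt_of_le_of_ne (Nat.lt_succ_iff.1 hj) fun h => ?_, hxj⟩)
        exact hxi (he h ▸ hxj)
    exact (Submodule.disjoint_def.1 (Submodule.orthogonal_disjoint _)) _ h1 (hinv _ f u hu.2)
  · exact not_finiteDimensional_cellSubspace hρ' hr hsep e

end Decomposition

section Preliminaries

variable {𝕜 H : Type*} [RCLike 𝕜] [NormedAddCommGroup H] [InnerProductSpace 𝕜 H]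

theorem isCompactOperator_sum {κ : Type*} (s : Finset κ) (A : κ → H →L[𝕜] H)
    (h : ∀ i ∈ s, IsCompactOperator (A i)) : IsCompactOperator (∑ i ∈ s, A i : H →L[𝕜] H) :=
  Finset.sum_induction A (fun B : H →L[𝕜] H => IsCompactOperator B) (fun _ _ hA hB => hA.add hB)
    isCompactOperator_zero h

theorem countable_of_orthonormal [TopologicalSpace.SeparableSpace H] {w : Set H}
    (hw : Orthonormal 𝕜 ((↑) : w → H)) : w.Countable := by
  refine Set.PairwiseDisjoint.countable_of_isOpen (s := fun x => Metric.ball x (1 / 2))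
    (fun x hx y hy hxy => ?_) (fun _ _ => Metric.isOpen_ball)
    (fun x _ => ⟨x, Metric.mem_ball_self (by norm_num)⟩)
  refine Metric.ball_disjoint_ball ?_
  have h0 : inner 𝕜 x y = 0 :=
    hw.2 (i := ⟨x, hx⟩) (j := ⟨y, hy⟩) fun h => hxy (congrArg Subtype.val h)
  have hx1 : ‖x‖ = 1 := hw.1 ⟨x, hx⟩
  have hy1 : ‖y‖ = 1 := hw.1 ⟨y, hy⟩
  have h1 := @norm_sub_sq 𝕜 _ _ _ _ x y
  rw [h0, hx1, hy1, map_zero] at h1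
  rw [dist_eq_norm]
  nlinarith [norm_nonneg (x - y)]

end Preliminaries

/-! ### Characterization of locally compact and controlled operators -/

section Characterization

variable {𝕜 X H ι : Type*} [RCLike 𝕜] [MetricSpace X]
    [NormedAddCommGroup H] [InnerProductSpace 𝕜 H] [CompleteSpace H]
    {ρ : C₀(X, 𝕜) →⋆ₙₐ[𝕜] (H →L[𝕜] H)} {p : ι → X} {r : ℝ} {G : ι → Submodule 𝕜 H}

theorem dense_span_iUnion (h : (⨆ i, G i)ᗮ = ⊥) :
    Dense (Submodule.span 𝕜 (⋃ i, (G i : Set H)) : Set H) := by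
  rw [← Submodule.iSup_eq_span]
  exact Submodule.dense_iff_topologicalClosure_eq_top.2
    (Submodule.topologicalClosure_eq_top_iff.2 h)

theorem ext_of_iSup_orthogonal (h : (⨆ i, G i)ᗮ = ⊥) {A B : H →L[𝕜] H}
    (hAB : ∀ i, ∀ u ∈ G i, A u = B u) : A = B := by
  refine ContinuousLinearMap.ext_on (dense_span_iUnion h) fun u hu => ?_
  obtain ⟨i, hi⟩ := Set.mem_iUnion.1 hu
  exact hAB i u hi

theorem eq_zero_of_iSup_orthogonal (h : (⨆ i, G i)ᗮ = ⊥) {v : H}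
    (hv : ∀ i, ∀ u ∈ G i, inner 𝕜 u v = 0) : v = 0 := by
  refine Dense.eq_zero_of_inner_right 𝕜 (Submodule.dense_iff_topologicalClosure_eq_top.2
    (Submodule.topologicalClosure_eq_top_iff.2 h)) fun u hu => ?_
  have hle : ⨆ i, G i ≤ (𝕜 ∙ v)ᗮ :=
    iSup_le fun i u hu => Submodule.mem_orthogonal_singleton_iff_inner_left.2 (hv i u hu)
  exact Submodule.mem_orthogonal_singleton_iff_inner_left.1 (hle hu)

/-- For nondegenerate `ρ`, a function that is `1` on the ball about `p i` acts as the identity on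
`G i`. -/
theorem IsLocalizedDecomposition.rep_cutoff_apply [ProperSpace X] (hρ : Nondegenerate ρ)
    (hG : IsLocalizedDecomposition ρ p r G) (i : ι) {u : H} (hu : u ∈ G i) :
    ρ (ofCompactSupport 𝕜 (cutoff (p i) r) (hasCompactSupport_cutoff (p i) r)) u = u := by
  set χ := ofCompactSupport 𝕜 (cutoff (p i) r) (hasCompactSupport_cutoff (p i) r) with hχ
  refine sub_eq_zero.1 (hρ.eq_zero_of_forall_rep fun f => ?_)
  have h0 := hG.localized i (f * χ - f) (fun x hx => ?_) u hu
  · rw [map_sub, sub_apply, rep_mul_apply] at h0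
    rw [map_sub, h0]
  · rw [ZeroAtInftyContinuousMap.sub_apply, ZeroAtInftyContinuousMap.mul_apply, hχ,
      ofCompactSupport_apply, cutoff_eq_one (Metric.mem_ball.1 hx).le]
    simp

theorem tsupport_ofCompactSupport_cutoff [ProperSpace X] (x : X) (s : ℝ) :
    tsupport (ofCompactSupport 𝕜 (cutoff x s) (hasCompactSupport_cutoff x s))
      ⊆ Metric.closedBall x (s + 1) := by
  refine (closure_mono fun z hz => ?_).trans (tsupport_cutoff x s)
  intro h
  refine hz ?_
  change ((cutoff x s z : ℝ) : 𝕜) = 0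
  rw [h, RCLike.ofReal_zero]

/-- `T` is controlled if and only if its matrix with respect to the decomposition has bounded
width, measured by the distances of the points `p i`. -/
theorem IsLocalizedDecomposition.controlled_iff [ProperSpace X] (hρ : Nondegenerate ρ)
    (hr : 0 < r) (hG : IsLocalizedDecomposition ρ p r G) {T : H →L[𝕜] H} :
    Controlled ρ T ↔ ∃ R : ℝ, ∀ i j, R < dist (p i) (p j) → ∀ u ∈ G i, ∀ v ∈ G j,
      inner 𝕜 u (T v) = 0 := by
  constructor
  · rintro ⟨R, -, hT⟩
    refine ⟨R + (r + 1) + (r + 1), fun i j hij u hu v hv => ?_⟩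
    rw [← hG.rep_cutoff_apply hρ i hu, ← hG.rep_cutoff_apply hρ j hv, inner_rep_left,
      star_ofCompactSupport]
    have hcs : ∀ k, HasCompactSupport
        (ofCompactSupport 𝕜 (cutoff (p k) r) (hasCompactSupport_cutoff (p k) r)) := fun k =>
      (isCompact_closedBall _ _).of_isClosed_subset (isClosed_tsupport _)
        (tsupport_ofCompactSupport_cutoff (p k) r)
    have h0 := rep_mul_mul_rep_eq_zero hT _ _ (hcs i) (hcs j) (fun x hx y hy => by
      have h1 := Metric.mem_closedBall.1 (tsupport_ofCompactSupport_cutoff (p i) r hx)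
      have h2 := Metric.mem_closedBall.1 (tsupport_ofCompactSupport_cutoff (p j) r hy)
      have h3 := dist_triangle4 (p i) x y (p j)
      rw [dist_comm (p i) x] at h3
      linarith)
    have h1 := congrArg (fun S : H →L[𝕜] H => inner 𝕜 u (S v)) h0
    exact h1.trans (inner_zero_right u)
  · rintro ⟨R, hR⟩
    refine ⟨max R 0 + 2 * (r + 1), by positivity, fun q hq => ?_⟩
    by_contra hlt
    push Not at hlt
    refine hq ⟨Metric.ball q.1 1, Metric.ball q.2 1, Metric.isOpen_ball,
      Metric.mem_ball_self one_pos, Metric.isOpen_ball, Metric.mem_ball_self one_pos,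
      fun f g hf hg => ?_⟩
    have hfar : ∀ (i : ι) (x : X) (f : C₀(X, 𝕜)), (∀ z ∉ Metric.ball x 1, f z = 0) →
        r + 1 ≤ dist (p i) x → ∀ u ∈ G i, ρ f u = 0 := by
      intro i x f hf hix u hu
      refine hG.localized i f (fun z hz => hf z fun hz' => ?_) u hu
      have h1 := Metric.mem_ball.1 hz
      have h2 := Metric.mem_ball.1 hz'
      linarith [dist_triangle_left (p i) x z]
    refine ext_of_iSup_orthogonal hG.total fun j v hv => ?_
    refine eq_zero_of_iSup_orthogonal hG.total fun i u hu => ?_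
    change inner 𝕜 u (ρ f (T (ρ g v))) = 0
    rw [inner_rep_right]
    by_cases hi : r + 1 ≤ dist (p i) q.1
    · rw [hfar i q.1 (star f) (fun z hz => star_apply_eq_zero (hf z hz)) hi u hu, inner_zero_left]
    by_cases hj : r + 1 ≤ dist (p j) q.2
    · rw [hfar j q.2 g hg hj v hv, map_zero, inner_zero_right]
    push Not at hi hj
    refine hR i j ?_ _ (hG.invariant i _ u hu) _ (hG.invariant j _ v hv)
    have h3 := dist_triangle4 q.1 (p i) (p j) q.2
    rw [dist_comm q.1 (p i)] at h3
    linarith [le_max_left R 0]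

theorem IsLocalizedDecomposition.isCompactOperator_mul_starProjection [ProperSpace X]
    [∀ i, CompleteSpace (G i)] (hρ : Nondegenerate ρ) (hG : IsLocalizedDecomposition ρ p r G)
    {T : H →L[𝕜] H} (hT : ∀ f, IsCompactOperator (T * ρ f)) (i : ι) :
    IsCompactOperator (T * (G i).starProjection) := by
  have h := (hT (ofCompactSupport 𝕜 (cutoff (p i) r)
    (hasCompactSupport_cutoff (p i) r))).comp_clm (G i).starProjection
  convert! h using 1
  ext v
  exact congrArg T (hG.rep_cutoff_apply hρ i ((G i).starProjection_apply_mem v)).symm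

/-- If the points `p i` are locally finite, then `ρ f` for compactly supported `f` only involves
finitely many of the pieces. -/
theorem IsLocalizedDecomposition.isCompactOperator_mul_rep [ProperSpace X]
    [∀ i, CompleteSpace (G i)] (hG : IsLocalizedDecomposition ρ p r G)
    (hfin : ∀ (x : X) (R : ℝ), {i | dist (p i) x ≤ R}.Finite)
    {T : H →L[𝕜] H} (hT : ∀ i, IsCompactOperator (T * (G i).starProjection)) (f : C₀(X, 𝕜)) :
    IsCompactOperator (T * ρ f) := by
  have hcl : IsClosed {A : H →L[𝕜] H | IsCompactOperator (T * A)} :=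
    (isClosed_setOfPred_isCompactOperator (𝕜₁ := 𝕜) (σ₁₂ := RingHom.id 𝕜) (M₁ := H)
      (M₂ := H)).preimage (continuous_const_mul T)
  refine rep_mem_of_hasCompactSupport hcl (fun g hg => ?_) f
  change IsCompactOperator (T * ρ g)
  have hF : ∃ F : Finset ι, ∀ i ∉ F, ∀ u ∈ G i, ρ g u = 0 := by
    rcases isEmpty_or_nonempty X with hX | ⟨⟨x⟩⟩
    · exact ⟨∅, fun i => hX.elim (p i)⟩
    obtain ⟨R, hR⟩ := hg.isCompact.isBounded.subset_closedBall x
    refine ⟨(hfin x (R + r)).toFinset, fun i hi u hu => hG.localized i g (fun z hz => ?_) u hu⟩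
    refine image_eq_zero_of_notMem_tsupport fun hz' => hi ?_
    have h1 := Metric.mem_ball.1 hz
    have h2 := Metric.mem_closedBall.1 (hR hz')
    rw [Set.Finite.mem_toFinset]
    change dist (p i) x ≤ R + r
    linarith [dist_triangle_left (p i) x z]
  obtain ⟨F, hF⟩ := hF
  classical
  have hsum : T * ρ g = ∑ i ∈ F, T * (G i).starProjection * ρ g := by
    refine ext_of_iSup_orthogonal hG.total fun j u hu => ?_
    rw [sum_apply]
    have hterm : ∀ i, (T * (G i).starProjection * ρ g) u = if i = j then T (ρ g u) else 0 := by
      intro i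
      change T ((G i).starProjection (ρ g u)) = _
      split_ifs with hij
      · subst hij
        rw [Submodule.starProjection_eq_self_iff.2 (hG.invariant i g u hu)]
      · rw [(G i).starProjection_apply_eq_zero_iff.2, map_zero]
        exact (hG.isOrtho j i (Ne.symm hij)).le (hG.invariant j g u hu)
    rw [Finset.sum_congr rfl fun i _ => hterm i, Finset.sum_ite_eq' F j]
    split_ifs with hj
    · rfl
    · change T (ρ g u) = 0
      rw [hF j hj u hu, map_zero]
  rw [hsum]
  exact isCompactOperator_sum F _ fun i _ => (hT i).comp_clm (ρ g)

theorem isCompactOperator_star_iff {A : H →L[𝕜] H} :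
    IsCompactOperator (star A : H →L[𝕜] H) ↔ IsCompactOperator A :=
  ⟨fun h => by simpa using isCompactOperator_adjoint h, isCompactOperator_adjoint⟩

theorem IsLocalizedDecomposition.locallyCompactOp_iff [ProperSpace X]
    [∀ i, CompleteSpace (G i)] (hρ : Nondegenerate ρ) (hG : IsLocalizedDecomposition ρ p r G)
    (hfin : ∀ (x : X) (R : ℝ), {i | dist (p i) x ≤ R}.Finite) {T : H →L[𝕜] H} :
    LocallyCompactOp ρ T ↔ ∀ i, IsCompactOperator ((G i).starProjection * T) ∧
      IsCompactOperator (T * (G i).starProjection) := by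
  have hiff : ∀ S : H →L[𝕜] H, (∀ f, IsCompactOperator (S * ρ f)) ↔
      ∀ i, IsCompactOperator (S * (G i).starProjection) := fun S =>
    ⟨hG.isCompactOperator_mul_starProjection hρ, hG.isCompactOperator_mul_rep hfin⟩
  have h1 : (∀ f, IsCompactOperator (ρ f * T)) ↔
      ∀ f, IsCompactOperator (star T * ρ f) := by
    constructor <;> intro h f <;> rw [← isCompactOperator_star_iff, star_mul, ← map_star]
    · rw [star_star]
      exact h _
    · exact h _
  have h2 : (∀ i, IsCompactOperator ((G i).starProjection * T)) ↔
      ∀ i, IsCompactOperator (star T * (G i).starProjection) := by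
    refine forall_congr' fun i => ?_
    rw [← isCompactOperator_star_iff, star_mul, (isSelfAdjoint_starProjection (G i)).star_eq]
  unfold LocallyCompactOp
  rw [forall_and, forall_and, h1, h2, hiff, hiff]

end Characterization

/-! ### Unitaries matching two decompositions -/

section Unitary

variable {𝕜 H K : Type*} [RCLike 𝕜]
    [NormedAddCommGroup H] [InnerProductSpace 𝕜 H] [CompleteSpace H]
    [NormedAddCommGroup K] [InnerProductSpace 𝕜 K] [CompleteSpace K]

theorem nonempty_hilbertBasis_nat [TopologicalSpace.SeparableSpace H]
    (h : ¬ FiniteDimensional 𝕜 H) : Nonempty (HilbertBasis ℕ 𝕜 H) := by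
  obtain ⟨w, b, hb⟩ := exists_hilbertBasis 𝕜 H
  have hw : Orthonormal 𝕜 ((↑) : w → H) := hb ▸ b.orthonormal
  have : Countable w := (countable_of_orthonormal hw).to_subtype
  have : Infinite w := by
    by_contra hfin
    rw [not_infinite_iff_finite] at hfin
    have := Fintype.ofFinite w
    exact h b.toOrthonormalBasis.toBasis.finiteDimensional_of_finite
  obtain ⟨e⟩ : Nonempty (ℕ ≃ w) := nonempty_equiv_of_countable
  refine ⟨HilbertBasis.mk (b.orthonormal.comp e e.injective) ?_⟩
  rw [e.surjective.range_comp b, b.dense_span]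

theorem nonempty_linearIsometryEquiv [TopologicalSpace.SeparableSpace H]
    [TopologicalSpace.SeparableSpace K] (hH : ¬ FiniteDimensional 𝕜 H)
    (hK : ¬ FiniteDimensional 𝕜 K) : Nonempty (H ≃ₗᵢ[𝕜] K) := by
  obtain ⟨b⟩ := nonempty_hilbertBasis_nat hH
  obtain ⟨b'⟩ := nonempty_hilbertBasis_nat hK
  exact ⟨b.repr.trans b'.repr.symm⟩

/-- Two orthogonal decompositions with infinite-dimensional pieces and the same index set are
matched by a unitary. -/
theorem exists_unitary_map_eq [TopologicalSpace.SeparableSpace H]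
    [TopologicalSpace.SeparableSpace K] {ι : Type*} {G : ι → Submodule 𝕜 H}
    {G' : ι → Submodule 𝕜 K} [∀ i, CompleteSpace (G i)] [∀ i, CompleteSpace (G' i)]
    (hG : ∀ i j, i ≠ j → G i ⟂ G j) (hG' : ∀ i j, i ≠ j → G' i ⟂ G' j)
    (ht : (⨆ i, G i)ᗮ = ⊥) (ht' : (⨆ i, G' i)ᗮ = ⊥)
    (hinf : ∀ i, ¬ FiniteDimensional 𝕜 (G i)) (hinf' : ∀ i, ¬ FiniteDimensional 𝕜 (G' i)) :
    ∃ U : H ≃ₗᵢ[𝕜] K, ∀ i, (G i).map (U.toLinearEquiv : H →ₗ[𝕜] K) = G' i := by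
  classical
  have : SecondCountableTopology H := UniformSpace.secondCountable_of_separable H
  have : SecondCountableTopology K := UniformSpace.secondCountable_of_separable K
  have e : ∀ i, G i ≃ₗᵢ[𝕜] G' i := fun i =>
    (nonempty_linearIsometryEquiv (hinf i) (hinf' i)).some
  have hrange : ∀ i, LinearMap.range
      (((G' i).subtypeₗᵢ.comp (e i).toLinearIsometry).toLinearMap) = G' i := by
    intro i
    ext v
    constructor
    · rintro ⟨u, rfl⟩
      exact (e i u).2
    · intro hv
      exact ⟨(e i).symm ⟨v, hv⟩, by simp⟩
  have h1 : IsHilbertSum 𝕜 (fun i => G i) fun i => (G i).subtypeₗᵢ :=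
    IsHilbertSum.mkInternal G
      (fun i j hij u v => Submodule.IsOrtho.inner_eq (hG i j hij) u.2 v.2)
      (Submodule.topologicalClosure_eq_top_iff.2 ht).ge
  have h2 : IsHilbertSum 𝕜 (fun i => G i)
      fun i => (G' i).subtypeₗᵢ.comp (e i).toLinearIsometry := by
    refine IsHilbertSum.mk
      (fun i j hij u v => Submodule.IsOrtho.inner_eq (hG' i j hij) (e i u).2 (e j v).2) ?_
    rw [iSup_congr hrange]
    exact (Submodule.topologicalClosure_eq_top_iff.2 ht').ge
  refine ⟨h1.linearIsometryEquiv.trans h2.linearIsometryEquiv.symm, fun i => ?_⟩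
  have hU : ∀ u : G i, (h1.linearIsometryEquiv.trans h2.linearIsometryEquiv.symm) (u : H)
      = e i u := by
    intro u
    have h3 : h1.linearIsometryEquiv (u : H) = lp.single 2 i u := by
      rw [← LinearIsometryEquiv.eq_symm_apply, h1.linearIsometryEquiv_symm_apply_single]
      rfl
    rw [LinearIsometryEquiv.trans_apply, h3, h2.linearIsometryEquiv_symm_apply_single]
    rfl
  ext v
  constructor
  · rintro ⟨u, hu, rfl⟩
    change (h1.linearIsometryEquiv.trans h2.linearIsometryEquiv.symm) u ∈ G' i
    rw [hU ⟨u, hu⟩]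
    exact (e i _).2
  · intro hv
    refine ⟨(e i).symm ⟨v, hv⟩, ((e i).symm ⟨v, hv⟩).2, ?_⟩
    exact (hU _).trans (by simp)

theorem isCompactOperator_conj (U : H ≃ₗᵢ[𝕜] K) {A : H →L[𝕜] H} (hA : IsCompactOperator A) :
    IsCompactOperator (U.conjStarAlgEquiv A) :=
  (hA.comp_clm (U.symm.toContinuousLinearEquiv : K →L[𝕜] H)).clm_comp
    (U.toContinuousLinearEquiv : H →L[𝕜] K)

/-- Conjugation by `U` maps the orthogonal projection onto `G` to the one onto `U G`. -/
theorem conj_starProjection (U : H ≃ₗᵢ[𝕜] K) {G : Submodule 𝕜 H} {G' : Submodule 𝕜 K}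
    [CompleteSpace G] [CompleteSpace G'] (h : G.map (U.toLinearEquiv : H →ₗ[𝕜] K) = G') :
    U.conjStarAlgEquiv G.starProjection = G'.starProjection := by
  subst h
  ext v
  exact (Submodule.starProjection_map_apply U G v).symm

end Unitary

section Transport

variable {𝕜 A B H K ι : Type*} [RCLike 𝕜] [MetricSpace A] [ProperSpace A]
    [MetricSpace B] [ProperSpace B]
    [NormedAddCommGroup H] [InnerProductSpace 𝕜 H] [CompleteSpace H]
    [NormedAddCommGroup K] [InnerProductSpace 𝕜 K] [CompleteSpace K]
    {ρA : C₀(A, 𝕜) →⋆ₙₐ[𝕜] (H →L[𝕜] H)} {ρB : C₀(B, 𝕜) →⋆ₙₐ[𝕜] (K →L[𝕜] K)}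
    {p : ι → A} {q : ι → B} {r s c : ℝ} {G : ι → Submodule 𝕜 H} {G' : ι → Submodule 𝕜 K}

/-- Local compactness and control are expressed through the pieces and the distances of their
base points alone. A unitary that matches the pieces therefore preserves both, if passing from `p`
to `q` increases distances at most by a constant. -/
theorem conj_mem_locallyCompactControlled (hρA : Nondegenerate ρA) (hρB : Nondegenerate ρB)
    (hr : 0 < r) (hs : 0 < s) (hG : IsLocalizedDecomposition ρA p r G)
    (hG' : IsLocalizedDecomposition ρB q s G')
    (hp : ∀ (x : A) (R : ℝ), {i | dist (p i) x ≤ R}.Finite)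
    (hq : ∀ (x : B) (R : ℝ), {i | dist (q i) x ≤ R}.Finite)
    (hpq : ∀ i j, dist (q i) (q j) ≤ dist (p i) (p j) + c)
    (U : H ≃ₗᵢ[𝕜] K) (hU : ∀ i, (G i).map (U.toLinearEquiv : H →ₗ[𝕜] K) = G' i)
    {T : H →L[𝕜] H} (hT : T ∈ locallyCompactControlled ρA) :
    U.conjStarAlgEquiv T ∈ locallyCompactControlled ρB := by
  have := fun i => (hG.isClosed i).completeSpace_coe
  have := fun i => (hG'.isClosed i).completeSpace_coe
  refine ⟨(hG'.locallyCompactOp_iff hρB hq).2 fun i => ?_, (hG'.controlled_iff hρB hs).2 ?_⟩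
  · obtain ⟨h1, h2⟩ := (hG.locallyCompactOp_iff hρA hp).1 hT.1 i
    rw [← conj_starProjection U (hU i), ← map_mul, ← map_mul]
    exact ⟨isCompactOperator_conj U h1, isCompactOperator_conj U h2⟩
  · obtain ⟨R, hR⟩ := (hG.controlled_iff hρA hr).1 hT.2
    refine ⟨R + c, fun i j hij u hu v hv => ?_⟩
    rw [← hU i] at hu
    rw [← hU j] at hv
    obtain ⟨u, hu, rfl⟩ := hu
    obtain ⟨v, hv, rfl⟩ := hv
    change inner 𝕜 (U u) (U (T (U.symm (U v)))) = 0
    rw [U.inner_map_map, U.symm_apply_apply]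
    exact hR i j (by linarith [hpq i j]) u hu v hv

/-- A unitary that matches the locally compact, controlled operators matches the Roe algebras. -/
theorem unitarilyIsomorphic_of_conj_mem (hρA : Nondegenerate ρA) (hρB : Nondegenerate ρB)
    (U : H ≃ₗᵢ[𝕜] K)
    (h : ∀ T ∈ locallyCompactControlled ρA, U.conjStarAlgEquiv T ∈ locallyCompactControlled ρB)
    (h' : ∀ T ∈ locallyCompactControlled ρB,
      U.symm.conjStarAlgEquiv T ∈ locallyCompactControlled ρA) :
    UnitarilyIsomorphic (roeAlgebra ρA) (roeAlgebra ρB) := by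
  have hcont : Continuous (fun T : H →L[𝕜] H => U.conjStarAlgEquiv T) := by
    simp only [LinearIsometryEquiv.conjStarAlgEquiv_apply]
    fun_prop
  have hcont' : Continuous (fun T : K →L[𝕜] K => U.symm.conjStarAlgEquiv T) := by
    simp only [LinearIsometryEquiv.conjStarAlgEquiv_apply]
    fun_prop
  have hm : ∀ T ∈ roeAlgebra ρA, U.conjStarAlgEquiv T ∈ roeAlgebra ρB := by
    intro T hT
    rw [← SetLike.mem_coe, coe_roeAlgebra hρA] at hT
    rw [← SetLike.mem_coe, coe_roeAlgebra hρB]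
    exact map_mem_closure hcont hT h
  have hm' : ∀ T ∈ roeAlgebra ρB, U.symm.conjStarAlgEquiv T ∈ roeAlgebra ρA := by
    intro T hT
    rw [← SetLike.mem_coe, coe_roeAlgebra hρB] at hT
    rw [← SetLike.mem_coe, coe_roeAlgebra hρA]
    exact map_mem_closure hcont' hT h'
  let φ : roeAlgebra ρA ≃⋆ₐ[𝕜] roeAlgebra ρB :=
    { toFun := fun T => ⟨U.conjStarAlgEquiv T, hm T T.2⟩
      invFun := fun T => ⟨U.symm.conjStarAlgEquiv T, hm' T T.2⟩
      left_inv := fun T => Subtype.ext (U.conjStarAlgEquiv.symm_apply_apply (T : H →L[𝕜] H))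
      right_inv := fun T => Subtype.ext (U.conjStarAlgEquiv.apply_symm_apply (T : K →L[𝕜] K))
      map_mul' := fun S T => Subtype.ext (map_mul U.conjStarAlgEquiv (S : H →L[𝕜] H) T)
      map_add' := fun S T => Subtype.ext (map_add U.conjStarAlgEquiv (S : H →L[𝕜] H) T)
      map_star' := fun S => Subtype.ext (map_star U.conjStarAlgEquiv (S : H →L[𝕜] H))
      map_smul' := fun k S => Subtype.ext (map_smul U.conjStarAlgEquiv k (S : H →L[𝕜] H)) }
  exact ⟨U, φ, fun T v => rfl⟩

end Transport

/-! ### Separated nets -/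

/-- A separated family in a proper metric space is locally finite: a ball is covered by finitely
many balls of radius `4`, and each of these contains at most one point of the family. -/
theorem finite_setOf_dist_le {X ι : Type*} [MetricSpace X] [ProperSpace X] {p : ι → X}
    (hsep : ∀ i j, i ≠ j → 8 ≤ dist (p i) (p j)) (x : X) (R : ℝ) :
    {i | dist (p i) x ≤ R}.Finite := by
  obtain ⟨t, -, ht, hcov⟩ := (isCompact_closedBall x R).finite_cover_balls (e := 4) (by norm_num)
  have hex : ∀ i : ι, ∃ y, dist (p i) x ≤ R → y ∈ t ∧ dist (p i) y < 4 := by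
    intro i
    by_cases hi : dist (p i) x ≤ R
    · obtain ⟨y, hy, hiy⟩ := Set.mem_iUnion₂.1 (hcov (Metric.mem_closedBall.2 hi))
      exact ⟨y, fun _ => ⟨hy, hiy⟩⟩
    · exact ⟨x, fun h => absurd h hi⟩
  choose y hy using hex
  refine Set.Finite.of_finite_image (f := y) (ht.subset ?_) ?_
  · rintro _ ⟨i, hi, rfl⟩
    exact (hy i hi).1
  · intro i hi j hj hij
    by_contra hne
    have h1 := (hy i hi).2
    have h2 := (hy j hj).2
    rw [← hij] at h2
    linarith [hsep i j hne, dist_triangle_right (p i) (p j) (y i)]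

theorem countable_of_separated {X : Type*} [MetricSpace X] [ProperSpace X] {Z : Set X} {S : ℝ}
    (hS : 0 < S) (hsep : ∀ x ∈ Z, ∀ y ∈ Z, x ≠ y → S ≤ dist x y) : Z.Countable := by
  refine Set.PairwiseDisjoint.countable_of_isOpen (s := fun x => Metric.ball x (S / 2))
    (fun x hx y hy hxy => Metric.ball_disjoint_ball ?_) (fun _ _ => Metric.isOpen_ball)
    (fun x _ => ⟨x, Metric.mem_ball_self (by positivity)⟩)
  linarith [hsep x hx y hy hxy]

/-- A maximal `S`-separated subset is `S`-dense. -/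
theorem exists_separated_net (X : Type*) [MetricSpace X] {S : ℝ} (hS : 0 < S) :
    ∃ Z : Set X, (∀ x ∈ Z, ∀ y ∈ Z, x ≠ y → S ≤ dist x y) ∧ ∀ x, ∃ z ∈ Z, dist x z ≤ S := by
  obtain ⟨Z, hZ⟩ := zorn_subset {Z : Set X | ∀ x ∈ Z, ∀ y ∈ Z, x ≠ y → S ≤ dist x y} (by
    intro c hc hchain
    refine ⟨⋃₀ c, ?_, fun s hs => Set.subset_sUnion_of_mem hs⟩
    rintro x ⟨s, hs, hx⟩ y ⟨t, ht, hy⟩ hxy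
    rcases hchain.total hs ht with hst | hst
    · exact hc ht x (hst hx) y hy hxy
    · exact hc hs x hx y (hst hy) hxy)
  refine ⟨Z, hZ.prop, fun x => ?_⟩
  by_contra! hx
  have hins : insert x Z ∈ {Z : Set X | ∀ x ∈ Z, ∀ y ∈ Z, x ≠ y → S ≤ dist x y} := by
    rintro a (rfl | ha) b (rfl | hb) hab
    · exact absurd rfl hab
    · exact (hx b hb).le
    · rw [dist_comm]
      exact (hx a ha).le
    · exact hZ.prop a ha b hb hab
  have hxZ : x ∈ Z := hZ.le_of_ge hins (Set.subset_insert x Z) (Set.mem_insert x Z)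
  have := hx x hxZ
  rw [dist_self] at this
  linarith

/-! ### Coarsely dense subspaces -/

/-- Two proper metric spaces that embed isometrically and coarsely densely into the same metric
space have unitarily isomorphic Roe algebras. -/
theorem unitarilyIsomorphic_roeAlgebra {𝕜 E A B H K : Type*} [RCLike 𝕜] [MetricSpace E]
    [MetricSpace A] [ProperSpace A] [MetricSpace B] [ProperSpace B]
    [NormedAddCommGroup H] [InnerProductSpace 𝕜 H] [CompleteSpace H]
    [TopologicalSpace.SeparableSpace H]
    [NormedAddCommGroup K] [InnerProductSpace 𝕜 K] [CompleteSpace K]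
    [TopologicalSpace.SeparableSpace K]
    {a : A → E} {b : B → E} (ha : Isometry a) (hb : Isometry b)
    (hda : CoarselyDense (Set.range a)) (hdb : CoarselyDense (Set.range b))
    {ρA : C₀(A, 𝕜) →⋆ₙₐ[𝕜] (H →L[𝕜] H)} {ρB : C₀(B, 𝕜) →⋆ₙₐ[𝕜] (K →L[𝕜] K)}
    (hA : Nondegenerate ρA) (hA' : Ample ρA) (hB : Nondegenerate ρB) (hB' : Ample ρB) :
    UnitarilyIsomorphic (roeAlgebra ρA) (roeAlgebra ρB) := by
  obtain ⟨R, hR0, hR⟩ := hda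
  obtain ⟨R', hR0', hR'⟩ := hdb
  -- moving the net from `A` to `B` changes distances by at most `2 * R'`, and its points must
  -- stay `8`-separated
  obtain ⟨Z, hZ, hZA⟩ := exists_separated_net A (S := 8 + 2 * R') (by positivity)
  have hex : ∀ z : A, ∃ y : B, dist (a z) (b y) ≤ R' := by
    intro z
    obtain ⟨_, ⟨y, rfl⟩, hy⟩ := hR' (a z)
    exact ⟨y, hy⟩
  choose t ht using hex
  let p : Z → A := fun z => z
  let q : Z → B := fun z => t z
  have hpq : ∀ i j, dist (q i) (q j) ≤ dist (p i) (p j) + 2 * R' := by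
    intro i j
    rw [← hb.dist_eq, ← ha.dist_eq]
    have h1 := dist_triangle4 (b (q i)) (a (p i)) (a (p j)) (b (q j))
    rw [dist_comm (b (q i)) (a (p i))] at h1
    have h2 : dist (a (p i)) (b (q i)) ≤ R' := ht i
    have h3 : dist (a (p j)) (b (q j)) ≤ R' := ht j
    linarith
  have hqp : ∀ i j, dist (p i) (p j) ≤ dist (q i) (q j) + 2 * R' := by
    intro i j
    rw [← hb.dist_eq, ← ha.dist_eq]
    have h1 := dist_triangle4 (a (p i)) (b (q i)) (b (q j)) (a (p j))
    rw [dist_comm (b (q j)) (a (p j))] at h1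
    have h2 : dist (a (p i)) (b (q i)) ≤ R' := ht i
    have h3 : dist (a (p j)) (b (q j)) ≤ R' := ht j
    linarith
  have hp8' : ∀ i j, i ≠ j → 8 + 2 * R' ≤ dist (p i) (p j) := fun i j hij =>
    hZ i i.2 j j.2 fun h => hij (Subtype.ext h)
  have hp8 : ∀ i j, i ≠ j → 8 ≤ dist (p i) (p j) := fun i j hij => by linarith [hp8' i j hij]
  have hq8 : ∀ i j, i ≠ j → 8 ≤ dist (q i) (q j) := fun i j hij => by
    linarith [hp8' i j hij, hqp i j]
  have hpcov : ∀ x, ∃ i, dist x (p i) ≤ 8 + 2 * R' := fun x => by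
    obtain ⟨z, hz, hxz⟩ := hZA x
    exact ⟨⟨z, hz⟩, hxz⟩
  have hqcov : ∀ y, ∃ i, dist y (q i) ≤ R + (8 + 2 * R') + R' := by
    intro y
    obtain ⟨_, ⟨x, rfl⟩, hx⟩ := hR (b y)
    obtain ⟨i, hi⟩ := hpcov x
    refine ⟨i, ?_⟩
    rw [← hb.dist_eq]
    have h1 := dist_triangle4 (b y) (a x) (a (p i)) (b (q i))
    rw [ha.dist_eq] at h1
    have h2 : dist (a (p i)) (b (q i)) ≤ R' := ht i
    linarith
  have : Countable Z := (countable_of_separated (by positivity) hZ).to_subtype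
  obtain ⟨r, hr, G, hG⟩ := exists_isLocalizedDecomposition hA hA' hp8 hpcov
  obtain ⟨s, hs, G', hG'⟩ := exists_isLocalizedDecomposition hB hB' hq8 hqcov
  have := fun i => (hG.isClosed i).completeSpace_coe
  have := fun i => (hG'.isClosed i).completeSpace_coe
  obtain ⟨U, hU⟩ := exists_unitary_map_eq hG.isOrtho hG'.isOrtho hG.total hG'.total
    hG.infinite hG'.infinite
  have hU' : ∀ i, (G' i).map (U.symm.toLinearEquiv : K →ₗ[𝕜] H) = G i := by
    intro i
    ext v
    constructor
    · rintro ⟨u, hu, rfl⟩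
      rw [SetLike.mem_coe, ← hU i] at hu
      obtain ⟨w, hw, rfl⟩ := hu
      change U.symm (U w) ∈ G i
      rwa [U.symm_apply_apply]
    · intro hv
      exact ⟨U v, hU i ▸ Submodule.mem_map_of_mem hv, U.symm_apply_apply v⟩
  have hpfin := finite_setOf_dist_le hp8
  have hqfin := finite_setOf_dist_le hq8
  exact unitarilyIsomorphic_of_conj_mem hA hB U
    (fun T hT => conj_mem_locallyCompactControlled hA hB hr hs hG hG' hpfin hqfin hpq U hU hT)
    (fun T hT => conj_mem_locallyCompactControlled hB hA hs hr hG' hG hqfin hpfin hqp U.symm hU' hT)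

/-! ### The integer lattice and Delone sets -/

theorem coarselyDense_range_subtype_val {X : Type*} [MetricSpace X] {Y : Set X}
    (h : CoarselyDense Y) : CoarselyDense (Set.range ((↑) : Y → X)) := by
  rwa [Subtype.range_coe]

theorem coarselyDense_range_id (X : Type*) [MetricSpace X] :
    CoarselyDense (Set.range (id : X → X)) :=
  ⟨1, one_pos, fun x => ⟨x, ⟨x, rfl⟩, by simp⟩⟩

theorem isClosed_integerLattice (d : ℕ) : IsClosed (integerLattice d) := by
  have h : integerLattice d = ⋂ i, (fun x : EuclideanSpace ℝ (Fin d) => x i) ⁻¹'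
      Set.range ((↑) : ℤ → ℝ) := by
    ext x
    simp [integerLattice, eq_comm]
  rw [h]
  exact isClosed_iInter fun i => Int.isClosedEmbedding_coe_real.isClosed_range.preimage
    (by fun_prop)

theorem coarselyDense_integerLattice (d : ℕ) : CoarselyDense (integerLattice d) := by
  -- rounding down changes each of the `d` coordinates by at most `1`; the summand `1` makes the
  -- constant positive for `d = 0`
  refine ⟨√d + 1, by positivity, fun x => ⟨WithLp.toLp 2 fun i => (⌊x i⌋ : ℝ),
    fun i => ⟨⌊x i⌋, rfl⟩, ?_⟩⟩
  rw [EuclideanSpace.dist_eq]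
  refine (Real.sqrt_le_sqrt (y := d) ?_).trans (by linarith)
  calc ∑ i, dist (x i) (⌊x i⌋ : ℝ) ^ 2 ≤ ∑ _i : Fin d, (1 : ℝ) := by
        refine Finset.sum_le_sum fun i _ => pow_le_one₀ dist_nonneg ?_
        rw [Real.dist_eq, Int.self_sub_floor, Int.abs_fract]
        exact (Int.fract_lt_one _).le
    _ = d := by simp

theorem isClosed_deloneSet {X : Type*} [MetricSpace X] (D : Delone.DeloneSet X) :
    IsClosed D.carrier := by
  refine Metric.isClosed_of_pairwise_le_dist (ε := D.packingRadius)
    (NNReal.coe_pos.2 D.packingRadius_pos) fun x hx y hy hxy => ?_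
  exact (D.packingRadius_lt_dist_of_mem_ne hx hy hxy).le

theorem coarselyDense_deloneSet {X : Type*} [MetricSpace X] (D : Delone.DeloneSet X) :
    CoarselyDense D.carrier :=
  ⟨D.coveringRadius, NNReal.coe_pos.2 D.coveringRadius_pos, fun x =>
    D.exists_dist_le_coveringRadius x⟩

theorem isClosed_and_coarselyDense {d : ℕ} {A : Set (EuclideanSpace ℝ (Fin d))}
    (h : A = integerLattice d ∨
      ∃ D : Delone.DeloneSet (EuclideanSpace ℝ (Fin d)), D.carrier = A) :
    IsClosed A ∧ CoarselyDense A := by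
  rcases h with rfl | ⟨D, rfl⟩
  · exact ⟨isClosed_integerLattice d, coarselyDense_integerLattice d⟩
  · exact ⟨isClosed_deloneSet D, coarselyDense_deloneSet D⟩

end RoeAlg

theorem mainTheorem7 {𝕜 : Type*} [RCLike 𝕜] {H K : Type*}
    [NormedAddCommGroup H] [InnerProductSpace 𝕜 H] [CompleteSpace H]
    [TopologicalSpace.SeparableSpace H]
    [NormedAddCommGroup K] [InnerProductSpace 𝕜 K] [CompleteSpace K]
    [TopologicalSpace.SeparableSpace K] :
    -- a closed coarsely dense subset `Y` of a proper metric space `X`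
    (∀ (X : Type*) [MetricSpace X] [ProperSpace X] (Y : Set X),
      IsClosed Y → RoeAlg.CoarselyDense Y →
      ∀ (ρY : C₀(Y, 𝕜) →⋆ₙₐ[𝕜] (H →L[𝕜] H)) (ρX : C₀(X, 𝕜) →⋆ₙₐ[𝕜] (K →L[𝕜] K)),
        RoeAlg.Nondegenerate ρY → RoeAlg.Ample ρY →
        RoeAlg.Nondegenerate ρX → RoeAlg.Ample ρX →
        RoeAlg.UnitarilyIsomorphic (RoeAlg.roeAlgebra ρY) (RoeAlg.roeAlgebra ρX)) ∧
    -- the lattice `ℤᵈ` or a Delone set `A`, compared with `ℝᵈ`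
    (∀ (d : ℕ) (A : Set (EuclideanSpace ℝ (Fin d))),
      (A = RoeAlg.integerLattice d ∨
        ∃ D : Delone.DeloneSet (EuclideanSpace ℝ (Fin d)), D.carrier = A) →
      ∀ (ρA : C₀(A, 𝕜) →⋆ₙₐ[𝕜] (H →L[𝕜] H))
        (ρE : C₀(EuclideanSpace ℝ (Fin d), 𝕜) →⋆ₙₐ[𝕜] (K →L[𝕜] K)),
        RoeAlg.Nondegenerate ρA → RoeAlg.Ample ρA →
        RoeAlg.Nondegenerate ρE → RoeAlg.Ample ρE →
        RoeAlg.UnitarilyIsomorphic (RoeAlg.roeAlgebra ρA) (RoeAlg.roeAlgebra ρE)) ∧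
    -- any two of these subsets of `ℝᵈ`, compared with each other
    (∀ (d : ℕ) (A B : Set (EuclideanSpace ℝ (Fin d))),
      (A = RoeAlg.integerLattice d ∨
        ∃ D : Delone.DeloneSet (EuclideanSpace ℝ (Fin d)), D.carrier = A) →
      (B = RoeAlg.integerLattice d ∨
        ∃ D : Delone.DeloneSet (EuclideanSpace ℝ (Fin d)), D.carrier = B) →
      ∀ (ρA : C₀(A, 𝕜) →⋆ₙₐ[𝕜] (H →L[𝕜] H)) (ρB : C₀(B, 𝕜) →⋆ₙₐ[𝕜] (K →L[𝕜] K)),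
        RoeAlg.Nondegenerate ρA → RoeAlg.Ample ρA →
        RoeAlg.Nondegenerate ρB → RoeAlg.Ample ρB →
        RoeAlg.UnitarilyIsomorphic (RoeAlg.roeAlgebra ρA) (RoeAlg.roeAlgebra ρB)) := by
  refine ⟨fun X _ _ Y hY hYd ρY ρX hρY hρY' hρX hρX' => ?_,
    fun d A hA ρA ρE hρA hρA' hρE hρE' => ?_, fun d A B hA hB ρA ρB hρA hρA' hρB hρB' => ?_⟩
  · have := ProperSpace.of_isClosed hY
    exact RoeAlg.unitarilyIsomorphic_roeAlgebra isometry_subtype_coe isometry_id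
      (RoeAlg.coarselyDense_range_subtype_val hYd) (RoeAlg.coarselyDense_range_id X)
      hρY hρY' hρX hρX'
  · obtain ⟨hAc, hAd⟩ := RoeAlg.isClosed_and_coarselyDense hA
    have := ProperSpace.of_isClosed hAc
    exact RoeAlg.unitarilyIsomorphic_roeAlgebra isometry_subtype_coe isometry_id
      (RoeAlg.coarselyDense_range_subtype_val hAd) (RoeAlg.coarselyDense_range_id _)
      hρA hρA' hρE hρE'
  · obtain ⟨hAc, hAd⟩ := RoeAlg.isClosed_and_coarselyDense hA
    obtain ⟨hBc, hBd⟩ := RoeAlg.isClosed_and_coarselyDense hB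
    have := ProperSpace.of_isClosed hAc
    have := ProperSpace.of_isClosed hBc
    exact RoeAlg.unitarilyIsomorphic_roeAlgebra isometry_subtype_coe isometry_subtype_coe
      (RoeAlg.coarselyDense_range_subtype_val hAd) (RoeAlg.coarselyDense_range_subtype_val hBd)
      hρA hρA' hρB hρB'
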